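/- Let $\Bbbk$ be a field. Operads are symmetric $\Bbbk$-linear operads $\mathfrak P=(\mathfrak P(n))_{n\ge 1}$. Let $\mathrm{ComTrias}$ be the operad for which $\mathrm{ComTrias}(n)$ has a basis $e_H=e_H^{(n)}$, $H$ running over the nonempty subsets of $\{1,\dots,n\}$, with $e_K(e_{H_1},\dots,e_{H_m})=e_{K(H_1,\dots,H_m)}$, where $K(H_1,\dots,H_m)$ is the union over $i\in K$ of the copies of $H_i$ in the $i$-th block of $\{1,\dots,n_1+\dots+n_m\}$. For an operad $\mathfrak N$ let $\text{tri-}\mathfrak N=\mathrm{ComTrias}\otimes\mathfrak N$ (Hadamard product), and on a $\text{tri-}\mathfrak N$-algebra write $f^H$ for the operation $e_H\otimes f$. Let $C_2$ be the $\mathrm{ComTrias}$-algebra with basis $e_1,e_2$ in which $e_H(e_{i_1},\dots,e_{i_n})$ equals $e_1$ if all $i_j=1$, equals $e_2$ if $\{j: i_j=2\}=H$, and is $0$ otherwise. If $A$ is an $\mathfrak M$-algebra, then $C_2\otimes A$ is a $\text{tri-}\mathfrak M$-algebra via $f^H(x_1\otimes a_1,\dots,x_n\otimes a_n)=e_H(x_1,\dots,x_n)\otimes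 f(a_1,\dots,a_n)$. Let $\mathfrak N$ and $\mathfrak M$ be operads generated by sets $\Sigma$ and $\Sigma'$ of operations, all of arity at least $2$, and let $\omega:\mathfrak N\to\mathfrak M$ be a morphism of operads. For an $\mathfrak M$-algebra $A$ let $A^{(\omega)}$ be the $\mathfrak N$-algebra on the same space obtained through $\omega$. For an $\mathfrak N$-algebra $B$ let $\iota:B\to U_\omega(B)^{(\omega)}$ be the universal enveloping algebra of $B$: $U_\omega(B)$ is an $\mathfrak M$-algebra, $\iota$ is a homomorphism, and every homomorphism $\psi: B\to A^{(\omega)}$ with $A$ an $\mathfrak M$-algebra equals $\xi\circ\iota$ for a unique homomorphism $\xi:U_\omega(B)\to A$ of $\mathfrak M$-algebras. The notation $U_{\mathrm{id}\otimes\omega}$ is used likewise for the morphism $\mathrm{id}\otimes\omega:\text{tri-}\mathfrak N\to\text{tri-}\mathfrak M$. Let $T$ be a $\text{tri-}\mathfrak N$-algebra, let $T_0\subseteq T$ be the span of all elements $f^H(a_1,\dots,a_n)-f^K(a_1,\dots,a_n)$ with $f\in\Sigma$ of arity $n$, $a_i\in T$ and $\emptyset\ne H,K\subseteq\{1,\dots,n\}$,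 let $\bar T=T/T_0$, and let $\widetilde T=\bar T\oplus T$ be the $\mathfrak N$-algebra with operations $$f(\bar a_1+b_1,\dots,\bar a_n+b_n)=\overline{f^{K}(a_1,\dots,a_n)}+\sum_{\emptyset\ne H\subseteq\{1,\dots,n\}}f^H(c^H_1,\dots,c^H_n),\qquad c_i^H=\begin{cases}b_i,& i\in H,\\ a_i,& i\notin H,\end{cases}$$ for $f\in\Sigma$ of arity $n$ and $a_i,b_i\in T$ (the choice of nonempty $K$ is immaterial). **Theorem.** The subalgebra generated in the $\text{tri-}\mathfrak M$-algebra $C_2\otimes U_\omega(\widetilde T)$ by the set $\{e_1\otimes\iota(\bar a)+e_2\otimes\iota(a)\mid a\in T\}$ is isomorphic, as a $\text{tri-}\mathfrak M$-algebra, to $U_{\mathrm{id}\otimes\omega}(T)$; the isomorphism can be chosen so that the canonical image of each $a\in T$ in $U_{\mathrm{id}\otimes\omega}(T)$ corresponds to $e_1\otimes\iota(\bar a)+e_2\otimes\iota(a)$. -/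

import Mathlib

open scoped TensorProduct

universe t u v w

/-- The bijection between the leaves of two consecutive graftings `x(y₁, …, yₙ)(z₁, …, z_N)` and
`x(y₁(z…), …, yₙ(z…))`; both sides are enumerated from left to right. -/
def assocEquiv {n : ℕ} (m : Fin n → ℕ) (l : Fin (∑ i, m i) → ℕ) :
    Fin (∑ i, ∑ j, l (finSigmaFinEquiv ⟨i, j⟩)) ≃ Fin (∑ p, l p) :=
  finSigmaFinEquiv.symm.trans
    ((Equiv.sigmaCongrRight fun _ => finSigmaFinEquiv.symm).trans
      ((Equiv.sigmaAssoc fun (i : Fin n) (j : Fin (m i)) =>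
          Fin (l (finSigmaFinEquiv ⟨i, j⟩))).symm.trans
        ((Equiv.sigmaCongrLeft (β := fun p => Fin (l p)) finSigmaFinEquiv).trans
          finSigmaFinEquiv)))

/-- A block permutation acting inside the blocks. -/
def innerEquiv {n : ℕ} {m m' : Fin n → ℕ} (τ : ∀ i, Fin (m i) ≃ Fin (m' i)) :
    Fin (∑ i, m i) ≃ Fin (∑ i, m' i) :=
  finSigmaFinEquiv.symm.trans ((Equiv.sigmaCongrRight τ).trans finSigmaFinEquiv)

/-- A block permutation permuting the blocks. -/
def outerEquiv {n n' : ℕ} (σ : Fin n ≃ Fin n') (m : Fin n' → ℕ) :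
    Fin (∑ i, m (σ i)) ≃ Fin (∑ i, m i) :=
  finSigmaFinEquiv.symm.trans
    ((Equiv.sigmaCongrLeft (β := fun i => Fin (m i)) σ).trans finSigmaFinEquiv)

/-- The identification `{1, …, n} = {1, …, ∑_{i = 1}^{1} n}`. -/
def unitLeftEquiv (n : ℕ) : Fin n ≃ Fin (∑ _i : Fin 1, n) :=
  (Equiv.uniqueSigma fun _ : Fin 1 => Fin n).symm.trans finSigmaFinEquiv

/-- The identification `{1, …, n} = {1, …, ∑_{i = 1}^{n} 1}`. -/
def unitRightEquiv (n : ℕ) : Fin n ≃ Fin (∑ _i : Fin n, 1) :=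
  (Equiv.sigmaUnique (Fin n) fun _ => Fin 1).symm.trans finSigmaFinEquiv

lemma assocEquiv_apply {n : ℕ} (m : Fin n → ℕ) (l : Fin (∑ i, m i) → ℕ) (i : Fin n)
    (j : Fin (m i)) (t : Fin (l (finSigmaFinEquiv ⟨i, j⟩))) :
    assocEquiv m l (finSigmaFinEquiv ⟨i, finSigmaFinEquiv ⟨j, t⟩⟩) =
      finSigmaFinEquiv ⟨finSigmaFinEquiv ⟨i, j⟩, t⟩ := by
  simp [assocEquiv]
  exact ⟨rfl, HEq.rfl⟩

lemma innerEquiv_apply {n : ℕ} {m m' : Fin n → ℕ} (τ : ∀ i, Fin (m i) ≃ Fin (m' i))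
    (i : Fin n) (j : Fin (m i)) :
    innerEquiv τ (finSigmaFinEquiv ⟨i, j⟩) = finSigmaFinEquiv ⟨i, τ i j⟩ := by
  simp [innerEquiv]

lemma outerEquiv_apply {n n' : ℕ} (σ : Fin n ≃ Fin n') (m : Fin n' → ℕ)
    (i : Fin n) (j : Fin (m (σ i))) :
    outerEquiv σ m (finSigmaFinEquiv ⟨i, j⟩) = finSigmaFinEquiv ⟨σ i, j⟩ := by
  simp [outerEquiv]

lemma unitLeftEquiv_apply {n : ℕ} (j : Fin n) :
    unitLeftEquiv n j = finSigmaFinEquiv ⟨(0 : Fin 1), j⟩ := rfl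

lemma unitRightEquiv_apply {n : ℕ} (i : Fin n) :
    unitRightEquiv n i = finSigmaFinEquiv ⟨i, (0 : Fin 1)⟩ := rfl

/-- A symmetric `k`-linear operad: a collection of `S_n`-modules `Op n` (with `Op 0 = 0`, so that
only arities `n ≥ 1` occur) with a multilinear composition `x(y₁, …, yₙ)` that is associative,
unital and equivariant. The symmetric group actions are recorded as a functor on the groupoid of
the sets `Fin n` and their bijections (`Fin m ≃ Fin n` forces `m = n`): `map e x` is the operation
`x` with its `i`-th variable renamed to `e i`. -/
structure Operad (k : Type u) [Field k] where
  Op : ℕ → Type v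
  [addCommGroup : ∀ n, AddCommGroup (Op n)]
  [module : ∀ n, Module k (Op n)]
  subsingleton_zero : Subsingleton (Op 0)
  map : ∀ {m n : ℕ}, (Fin m ≃ Fin n) → Op m →ₗ[k] Op n
  map_refl : ∀ {n : ℕ} (x : Op n), map (Equiv.refl (Fin n)) x = x
  map_trans : ∀ {l m n : ℕ} (e : Fin l ≃ Fin m) (e' : Fin m ≃ Fin n) (x : Op l),
    map (e.trans e') x = map e' (map e x)
  one : Op 1
  comp : ∀ {n : ℕ} (m : Fin n → ℕ),
    Op n →ₗ[k] MultilinearMap k (fun i => Op (m i)) (Op (∑ i, m i))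
  one_comp : ∀ {n : ℕ} (x : Op n),
    comp (fun _ : Fin 1 => n) one (fun _ => x) = map (unitLeftEquiv n) x
  comp_one : ∀ {n : ℕ} (x : Op n),
    comp (fun _ : Fin n => 1) x (fun _ => one) = map (unitRightEquiv n) x
  comp_assoc : ∀ {n : ℕ} (m : Fin n → ℕ) (l : Fin (∑ i, m i) → ℕ)
    (x : Op n) (y : ∀ i, Op (m i)) (z : ∀ p, Op (l p)),
    comp l (comp m x y) z =
      map (assocEquiv m l)
        (comp (fun i => ∑ j, l (finSigmaFinEquiv ⟨i, j⟩)) x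
          (fun i => comp (fun j => l (finSigmaFinEquiv ⟨i, j⟩)) (y i)
            (fun j => z (finSigmaFinEquiv ⟨i, j⟩))))
  comp_map_right : ∀ {n : ℕ} (m m' : Fin n → ℕ) (τ : ∀ i, Fin (m i) ≃ Fin (m' i))
    (x : Op n) (y : ∀ i, Op (m i)),
    comp m' x (fun i => map (τ i) (y i)) = map (innerEquiv τ) (comp m x y)
  comp_map_left : ∀ {n n' : ℕ} (σ : Fin n ≃ Fin n') (m : Fin n' → ℕ)
    (x : Op n) (y : ∀ i, Op (m i)),
    comp m (map σ x) y =
      map (outerEquiv σ m) (comp (fun i => m (σ i)) x (fun i => y (σ i)))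

attribute [instance] Operad.addCommGroup Operad.module

namespace Operad

/-- Morphisms of operads. -/
structure Hom {k : Type u} [Field k] (N : Operad.{u, v} k) (M : Operad.{u, w} k) where
  toFun : ∀ n : ℕ, N.Op n →ₗ[k] M.Op n
  map_map : ∀ {m n : ℕ} (e : Fin m ≃ Fin n) (x : N.Op m),
    toFun n (N.map e x) = M.map e (toFun m x)
  map_one : toFun 1 N.one = M.one
  map_comp : ∀ {n : ℕ} (m : Fin n → ℕ) (x : N.Op n) (y : ∀ i, N.Op (m i)),
    toFun _ (N.comp m x y) = M.comp m (toFun n x) (fun i => toFun (m i) (y i))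

/-- A language `Sym` (with arities) together with a presentation of `P` as a quotient of the free
operad on that language: every `f` is interpreted by an operation `op f`, and these
operations generate `P`, i.e. lie in no proper suboperad. -/
structure Generators {k : Type u} [Field k] (P : Operad.{u, v} k) where
  Sym : Type w
  arity : Sym → ℕ
  op : ∀ f : Sym, P.Op (arity f)
  generates : ∀ S : ∀ n, Submodule k (P.Op n),
    P.one ∈ S 1 →
    (∀ (m n : ℕ) (e : Fin m ≃ Fin n) (x : P.Op m), x ∈ S m → P.map e x ∈ S n) →
    (∀ (n : ℕ) (m : Fin n → ℕ) (x : P.Op n) (y : ∀ i, P.Op (m i)),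
      x ∈ S n → (∀ i, y i ∈ S (m i)) → P.comp m x y ∈ S (∑ i, m i)) →
    (∀ f, op f ∈ S (arity f)) →
    ∀ n, S n = ⊤

/-- Algebras over an operad. An operation `x` of arity `n` acts as an `n`-linear map. -/
structure Algebra {k : Type u} [Field k] (P : Operad.{u, v} k) where
  carrier : Type w
  [addCommGroup : AddCommGroup carrier]
  [module : Module k carrier]
  act : ∀ {n : ℕ}, P.Op n →ₗ[k] MultilinearMap k (fun _ : Fin n => carrier) carrier
  act_one : ∀ a : Fin 1 → carrier, act P.one a = a 0
  act_map : ∀ {m n : ℕ} (e : Fin m ≃ Fin n) (x : P.Op m) (a : Fin n → carrier),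
    act (P.map e x) a = act x (fun i => a (e i))
  act_comp : ∀ {n : ℕ} (m : Fin n → ℕ) (x : P.Op n) (y : ∀ i, P.Op (m i))
    (a : Fin (∑ i, m i) → carrier),
    act (P.comp m x y) a = act x (fun i => act (y i) (fun j => a (finSigmaFinEquiv ⟨i, j⟩)))

attribute [instance] Algebra.addCommGroup Algebra.module

end Operad

namespace Operad.Algebra

/-- Homomorphisms of algebras over an operad. -/
structure Hom {k : Type u} [Field k] {P : Operad.{u, v} k}
    (A : P.Algebra) (B : P.Algebra) where
  toLin : A.carrier →ₗ[k] B.carrier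
  map_act : ∀ {n : ℕ} (x : P.Op n) (a : Fin n → A.carrier),
    toLin (A.act x a) = B.act x (fun i => toLin (a i))

/-- Isomorphisms of algebras over an operad. -/
structure Iso {k : Type u} [Field k] {P : Operad.{u, v} k}
    (A : P.Algebra) (B : P.Algebra) where
  toLin : A.carrier ≃ₗ[k] B.carrier
  map_act : ∀ {n : ℕ} (x : P.Op n) (a : Fin n → A.carrier),
    toLin (A.act x a) = B.act x (fun i => toLin (a i))

/-- The algebra `A^(ω)` over `N` on the same space as the algebra `A` over `M`, for an operad
morphism `ω : N → M`. -/
def restrict {k : Type u} [Field k] {N : Operad.{u, v} k} {M : Operad.{u, w} k}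
    (ω : N.Hom M) (A : M.Algebra) : N.Algebra where
  carrier := A.carrier
  act {n} := A.act.comp (ω.toFun n)
  act_one a := by simp [ω.map_one, A.act_one]
  act_map e x a := by simp [ω.map_map, A.act_map]
  act_comp m x y a := by simp [ω.map_comp, A.act_comp]

/-- The underlying space of the subalgebra generated by a set. -/
def adjoinSubmodule {k : Type u} [Field k] {P : Operad.{u, v} k} (A : P.Algebra)
    (s : Set A.carrier) : Submodule k A.carrier :=
  sInf {S | s ⊆ S ∧ ∀ (n : ℕ) (x : P.Op n) (a : Fin n → A.carrier),
    (∀ i, a i ∈ S) → A.act x a ∈ S}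

/-- The subalgebra generated by a set, as an algebra in its own right. -/
def adjoin {k : Type u} [Field k] {P : Operad.{u, v} k} (A : P.Algebra)
    (s : Set A.carrier) : P.Algebra where
  carrier := A.adjoinSubmodule s
  act {n} :=
    { toFun := fun x =>
        ((A.act x).compLinearMap fun _ => (A.adjoinSubmodule s).subtype).codRestrict
          (A.adjoinSubmodule s) (by
            intro a
            simp only [adjoinSubmodule, Submodule.mem_sInf]
            intro S hS
            exact hS.2 _ _ _ fun i => (Submodule.mem_sInf.1 (a i).2) S hS)
      map_add' := by intro x y; ext a; simp
      map_smul' := by intro c x; ext a; simp }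
  act_one a := by ext; simp [A.act_one]
  act_map e x a := by ext; simp [A.act_map]
  act_comp m x y a := by ext; simp [A.act_comp]

end Operad.Algebra

/-- Induction for statements that are additive in each of finitely many variables. -/
lemma pi_additive_induction {ι : Type*} [Finite ι] [DecidableEq ι] {X : ι → Type*}
    [∀ i, AddCommMonoid (X i)] (S : ∀ i, Set (X i))
    (hS : ∀ i, AddSubmonoid.closure (S i) = ⊤) (C : (∀ i, X i) → Prop)
    (hpure : ∀ x, (∀ i, x i ∈ S i) → C x)
    (hzero : ∀ x i, C (Function.update x i 0))
    (hadd : ∀ x i a b, C (Function.update x i a) → C (Function.update x i b) →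
      C (Function.update x i (a + b))) (x : ∀ i, X i) : C x := by
  classical
  have := Fintype.ofFinite ι
  suffices h : ∀ (s : Finset ι) (x : ∀ i, X i), (∀ i ∉ s, x i ∈ S i) → C x from
    h Finset.univ x (by simp)
  intro s
  induction s using Finset.induction_on with
  | empty => intro x hx; exact hpure x fun i => hx i (by simp)
  | insert i s hi ih =>
    intro x hx
    have key : ∀ a : X i, C (Function.update x i a) := by
      intro a
      have ha : a ∈ AddSubmonoid.closure (S i) := by rw [hS i]; trivial
      induction ha using AddSubmonoid.closure_induction with
      | mem a ha =>
        apply ih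
        intro j hj
        by_cases hji : j = i
        · subst hji; simpa using ha
        · rw [Function.update_of_ne hji]
          exact hx j (by simp [hji, hj])
      | zero => exact hzero x i
      | add a b _ _ iha ihb => exact hadd x i a b iha ihb
    simpa using key (x i)

/-- The nonempty subsets of `{1, …, n}`. -/
abbrev NESub (n : ℕ) : Type := {H : Finset (Fin n) // H.Nonempty}

namespace NESub

/-- Renaming of the elements of a subset. -/
def map {m n : ℕ} (e : Fin m ≃ Fin n) (H : NESub m) : NESub n :=
  ⟨H.1.map e.toEmbedding, H.2.map⟩

/-- The composition `K(H₁, …, Hₙ)` of sets: with `{1, …, m₁ + ⋯ + mₙ}` cut into consecutive blocks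
of lengths `m₁, …, mₙ`, it is the union of the copies of `Hᵢ` in the `i`-th block, `i ∈ K`. -/
def comp {n : ℕ} (m : Fin n → ℕ) (K : NESub n) (H : ∀ i, NESub (m i)) : NESub (∑ i, m i) :=
  ⟨(K.1.sigma fun i => (H i).1).map finSigmaFinEquiv.toEmbedding,
    (Finset.sigma_nonempty.2 (by
      obtain ⟨i, hi⟩ := K.2
      exact ⟨i, hi, (H i).2⟩)).map⟩

lemma mem_map {m n : ℕ} (e : Fin m ≃ Fin n) (H : NESub m) (i : Fin m) :
    e i ∈ (map e H).1 ↔ i ∈ H.1 := by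
  simp [map]

lemma mem_comp {n : ℕ} (m : Fin n → ℕ) (K : NESub n) (H : ∀ i, NESub (m i))
    (i : Fin n) (j : Fin (m i)) :
    finSigmaFinEquiv ⟨i, j⟩ ∈ (comp m K H).1 ↔ i ∈ K.1 ∧ j ∈ (H i).1 := by
  simp [comp]

end NESub

noncomputable section

namespace ComTrias

variable (k : Type u) [Field k]

/-- The action of the corolla `e_H` on the two-dimensional space `C₂ = k × k` with basis
`e₁ = (1, 0)`, `e₂ = (0, 1)`. On basis vectors, `e_H(e_{i₁}, …, e_{iₙ})` equals `e₁` if all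
`iⱼ = 1`, equals `e₂` if `{j | iⱼ = 2} = H`, and is `0` otherwise. -/
def corollaAct {n : ℕ} (H : NESub n) : MultilinearMap k (fun _ : Fin n => k × k) (k × k) :=
  ((MultilinearMap.mkPiAlgebra k (Fin n) k).compLinearMap
      fun _ => LinearMap.fst k k k).prod
    ((MultilinearMap.mkPiAlgebra k (Fin n) k).compLinearMap
      fun i => if i ∈ H.1 then LinearMap.snd k k k else LinearMap.fst k k k)

/-- The linear extension of `corollaAct`. -/
def actC2 {n : ℕ} :
    (NESub n →₀ k) →ₗ[k] MultilinearMap k (fun _ : Fin n => k × k) (k × k) :=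
  Finsupp.linearCombination k (corollaAct k)

/-- Composition in `ComTrias`: the multilinear extension of
`e_K(e_{H₁}, …, e_{Hₙ}) = e_{K(H₁, …, Hₙ)}`. -/
def compLin {n : ℕ} (m : Fin n → ℕ) :
    (NESub n →₀ k) →ₗ[k]
      MultilinearMap k (fun i => NESub (m i) →₀ k) (NESub (∑ i, m i) →₀ k) :=
  Finsupp.linearCombination k fun K =>
    ∑ H : ∀ i, NESub (m i),
      ((MultilinearMap.mkPiAlgebra k (Fin n) k).compLinearMap
        fun i => Finsupp.lapply (H i)).smulRight (Finsupp.single (NESub.comp m K H) 1)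

variable {k}

lemma corollaAct_apply {n : ℕ} (H : NESub n) (v : Fin n → k × k) :
    corollaAct k H v = (∏ i, (v i).1, ∏ i, if i ∈ H.1 then (v i).2 else (v i).1) := by
  simp only [corollaAct, MultilinearMap.prod_apply, MultilinearMap.compLinearMap_apply,
    MultilinearMap.mkPiAlgebra_apply, LinearMap.fst_apply]
  congr 1
  refine Finset.prod_congr rfl fun i _ => ?_
  split_ifs <;> rfl

lemma actC2_single {n : ℕ} (H : NESub n) (c : k) (v : Fin n → k × k) :
    actC2 k (Finsupp.single H c) v = c • corollaAct k H v := by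
  simp [actC2]

/-- The defining composition rule of `ComTrias`. -/
lemma compLin_single {n : ℕ} (m : Fin n → ℕ) (K : NESub n) (H : ∀ i, NESub (m i))
    (c : k) (r : Fin n → k) :
    compLin k m (Finsupp.single K c) (fun i => Finsupp.single (H i) (r i)) =
      Finsupp.single (NESub.comp m K H) (c * ∏ i, r i) := by
  classical
  simp only [compLin, Finsupp.linearCombination_single, _root_.smul_apply,
    _root_.sum_apply, MultilinearMap.smulRight_apply,
    MultilinearMap.compLinearMap_apply, MultilinearMap.mkPiAlgebra_apply,
    Finsupp.lapply_apply]
  rw [Finset.sum_eq_single H]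
  · simp
  · intro H' _ hne
    obtain ⟨i, hi⟩ := Function.ne_iff.1 hne
    rw [Finset.prod_eq_zero (Finset.mem_univ i), zero_smul]
    simp [Ne.symm hi]
  · simp

lemma actC2_injective {n : ℕ} {x y : NESub n →₀ k} (h : actC2 k x = actC2 k y) : x = y := by
  classical
  ext K
  have key : ∀ z : NESub n →₀ k,
      (actC2 k z fun i => if i ∈ K.1 then ((0, 1) : k × k) else (1, 0)).2 = z K := by
    intro z
    induction z using Finsupp.induction_linear with
    | zero => simp
    | add f g hf hg => simp [hf, hg]
    | single H c =>
      rw [actC2_single, corollaAct_apply]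
      by_cases hHK : H = K
      · subst hHK
        have : (∏ i, if i ∈ H.1 then (if i ∈ H.1 then ((0, 1) : k × k) else (1, 0)).2 else
            (if i ∈ H.1 then ((0, 1) : k × k) else (1, 0)).1) = 1 := by
          refine Finset.prod_eq_one fun i _ => ?_
          by_cases hi : i ∈ H.1 <;> simp [hi]
        simp [this]
      · have hne : ∃ i, ¬ (i ∈ H.1 ↔ i ∈ K.1) := by
          by_contra hcon
          push Not at hcon
          exact hHK (Subtype.ext (Finset.ext hcon))
        obtain ⟨i, hi⟩ := hne
        have : (∏ i, if i ∈ H.1 then (if i ∈ K.1 then ((0, 1) : k × k) else (1, 0)).2 else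
            (if i ∈ K.1 then ((0, 1) : k × k) else (1, 0)).1) = 0 := by
          refine Finset.prod_eq_zero (Finset.mem_univ i) ?_
          by_cases h1 : i ∈ H.1 <;> by_cases h2 : i ∈ K.1 <;> simp_all
        simp [this, hHK]
  rw [← key x, ← key y, h]

lemma actC2_map {m n : ℕ} (e : Fin m ≃ Fin n) (x : NESub m →₀ k) (v : Fin n → k × k) :
    actC2 k (Finsupp.lmapDomain k k (NESub.map e) x) v = actC2 k x fun i => v (e i) := by
  induction x using Finsupp.induction_linear with
  | zero => simp
  | add f g hf hg => simp only [map_add, _root_.add_apply, hf, hg]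
  | single H c =>
    rw [Finsupp.lmapDomain_apply, Finsupp.mapDomain_single, actC2_single, actC2_single,
      corollaAct_apply, corollaAct_apply, ← Equiv.prod_comp e, ← Equiv.prod_comp e]
    simp only [NESub.mem_map]

lemma prod_finSigma {n : ℕ} (m : Fin n → ℕ) (f : Fin (∑ i, m i) → k) :
    ∏ p, f p = ∏ i, ∏ j, f (finSigmaFinEquiv ⟨i, j⟩) := by
  rw [← Equiv.prod_comp finSigmaFinEquiv, Fintype.prod_sigma]

lemma actC2_comp {n : ℕ} (m : Fin n → ℕ) (x : NESub n →₀ k) (y : ∀ i, NESub (m i) →₀ k)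
    (v : Fin (∑ i, m i) → k × k) :
    actC2 k (compLin k m x y) v =
      actC2 k x fun i => actC2 k (y i) fun j => v (finSigmaFinEquiv ⟨i, j⟩) := by
  classical
  induction x using Finsupp.induction_linear with
  | zero => simp
  | add f g hf hg => simp only [map_add, _root_.add_apply, hf, hg]
  | single K c =>
    refine pi_additive_induction (S := fun i => {z | ∃ H r, z = Finsupp.single H r})
      (fun i => Finsupp.add_closure_setOfPred_eq_single)
      (C := fun y => actC2 k (compLin k m (Finsupp.single K c) y) v =
        actC2 k (Finsupp.single K c) fun i =>
          actC2 k (y i) fun j => v (finSigmaFinEquiv ⟨i, j⟩)) ?_ ?_ ?_ y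
    · intro y hy
      choose H r hy using hy
      obtain rfl : y = fun i => Finsupp.single (H i) (r i) := funext hy
      simp only [compLin_single, actC2_single, corollaAct_apply, prod_finSigma,
        NESub.mem_comp, Prod.smul_mk, smul_eq_mul]
      congr 1
      · rw [Finset.prod_mul_distrib, mul_assoc]
      · rw [mul_assoc, ← Finset.prod_mul_distrib]
        congr 1
        refine Finset.prod_congr rfl fun i _ => ?_
        by_cases hi : i ∈ K.1 <;> simp [hi]
    · intro y i
      rw [MultilinearMap.map_update_zero, map_zero, _root_.zero_apply]
      symm
      exact MultilinearMap.map_coord_zero _ i (by simp)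
    · intro y i a b ha hb
      rw [MultilinearMap.map_update_add, map_add, _root_.add_apply, ha, hb]
      have h : ∀ c, (fun i' => actC2 k (Function.update y i c i')
          fun j => v (finSigmaFinEquiv ⟨i', j⟩)) = Function.update
          (fun i' => actC2 k (y i') fun j => v (finSigmaFinEquiv ⟨i', j⟩)) i
          (actC2 k c fun j => v (finSigmaFinEquiv ⟨i, j⟩)) := by
        intro c
        funext i'
        by_cases hi : i' = i
        · subst hi; simp
        · simp [hi]
      rw [h, h, h, map_add, _root_.add_apply, MultilinearMap.map_update_add]

end ComTrias

/-- The operad `ComTrias`: `ComTrias(n)` has the basis `e_H`, `H` a nonempty subset of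
`{1, …, n}`, and `e_K(e_{H₁}, …, e_{Hₙ}) = e_{K(H₁, …, Hₙ)}`. -/
def ComTrias (k : Type u) [Field k] : Operad.{u, u} k where
  Op n := NESub n →₀ k
  subsingleton_zero :=
    have : IsEmpty (NESub 0) := ⟨fun H => by obtain ⟨i, -⟩ := H.2; exact i.elim0⟩
    inferInstance
  map e := Finsupp.lmapDomain k k (NESub.map e)
  map_refl x := ComTrias.actC2_injective (by ext1 v; rw [ComTrias.actC2_map]; rfl)
  map_trans e e' x := ComTrias.actC2_injective (by
    ext1 v; simp only [ComTrias.actC2_map, Equiv.trans_apply])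
  one := Finsupp.single ⟨{0}, by simp⟩ 1
  comp := ComTrias.compLin k
  one_comp x := ComTrias.actC2_injective (by
    ext1 v
    rw [ComTrias.actC2_comp, ComTrias.actC2_map, ComTrias.actC2_single,
      ComTrias.corollaAct_apply]
    simp [unitLeftEquiv_apply])
  comp_one x := ComTrias.actC2_injective (by
    ext1 v
    rw [ComTrias.actC2_comp, ComTrias.actC2_map]
    simp [ComTrias.actC2_single, ComTrias.corollaAct_apply, unitRightEquiv_apply])
  comp_assoc m l x y z := ComTrias.actC2_injective (by
    ext1 v
    simp only [ComTrias.actC2_comp, ComTrias.actC2_map]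
    exact congrArg _ (funext fun i => congrArg _ (funext fun j => congrArg _ (funext fun t =>
      congrArg v (assocEquiv_apply m l i j t).symm))))
  comp_map_right m m' τ x y := ComTrias.actC2_injective (by
    ext1 v
    simp only [ComTrias.actC2_comp, ComTrias.actC2_map]
    exact congrArg _ (funext fun i => congrArg _ (funext fun j =>
      congrArg v (innerEquiv_apply τ i j).symm)))
  comp_map_left σ m x y := ComTrias.actC2_injective (by
    ext1 v
    simp only [ComTrias.actC2_comp, ComTrias.actC2_map]
    exact congrArg _ (funext fun i => congrArg _ (funext fun j =>
      congrArg v (outerEquiv_apply σ m i j).symm)))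

namespace ComTrias

variable (k : Type u) [Field k]

/-- The basis element `e_H` of `ComTrias(n)`. -/
def corolla {n : ℕ} (H : NESub n) : (ComTrias k).Op n := Finsupp.single H (1 : k)

/-- The two-dimensional `ComTrias`-algebra `C₂` with basis `e₁, e₂`. -/
def C2 : (ComTrias k).Algebra where
  carrier := k × k
  act := actC2 k
  act_one a := by
    show actC2 k (Finsupp.single _ 1) a = _
    rw [actC2_single, corollaAct_apply]
    simp
  act_map e x a := actC2_map e x a
  act_comp m x y a := actC2_comp m x y a

/-- The first basis vector of `C₂`. -/
def e₁ : (C2 k).carrier := ((1, 0) : k × k)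

/-- The second basis vector of `C₂`. -/
def e₂ : (C2 k).carrier := ((0, 1) : k × k)

/-- The operations `x ⊥ y = e_{12}(x, y)` and `x ⊢ y = e_{2}(x, y)` of `ComTrias` have on `C₂` the
multiplication tables `eᵢ ⊥ eᵢ = eᵢ`, `e₁ ⊢ e₁ = e₁`, `e₁ ⊢ e₂ = e₂`, other products zero. -/
lemma C2_table :
    let perp (x y : (C2 k).carrier) := (C2 k).act (corolla k (n := 2) ⟨{0, 1}, by simp⟩) ![x, y]
    let vdash (x y : (C2 k).carrier) := (C2 k).act (corolla k (n := 2) ⟨{1}, by simp⟩) ![x, y]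
    (perp (e₁ k) (e₁ k) = e₁ k ∧ perp (e₁ k) (e₂ k) = 0 ∧
      perp (e₂ k) (e₁ k) = 0 ∧ perp (e₂ k) (e₂ k) = e₂ k) ∧
    (vdash (e₁ k) (e₁ k) = e₁ k ∧ vdash (e₁ k) (e₂ k) = e₂ k ∧
      vdash (e₂ k) (e₁ k) = 0 ∧ vdash (e₂ k) (e₂ k) = 0) := by
  have h : ∀ (H : NESub 2) (x y : k × k), (C2 k).act (corolla k H) ![x, y] =
      ((x.1 * y.1, (if 0 ∈ H.1 then x.2 else x.1) * (if 1 ∈ H.1 then y.2 else y.1)) : k × k) := by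
    intro H x y
    show actC2 k (Finsupp.single H 1) ![x, y] = _
    rw [actC2_single, corollaAct_apply]
    simp [Fin.prod_univ_two]
  simp only [e₁, e₂, h]
  refine ⟨⟨?_, ?_, ?_, ?_⟩, ?_, ?_, ?_, ?_⟩ <;> simp <;> rfl

end ComTrias


section Box

variable {k : Type u} [Field k]

lemma pure_tensor_closure (V W : Type*) [AddCommGroup V] [Module k V] [AddCommGroup W]
    [Module k W] :
    AddSubmonoid.closure {t : V ⊗[k] W | ∃ v w, t = v ⊗ₜ[k] w} = ⊤ := by
  rw [eq_top_iff]
  intro t _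
  induction t using TensorProduct.induction_on with
  | zero => exact zero_mem _
  | tmul v w => exact AddSubmonoid.subset_closure ⟨v, w, rfl⟩
  | add a b ha hb => exact add_mem (ha trivial) (hb trivial)

lemma multilinear_ext_pure {n : ℕ} {V W : Fin n → Type*} {Z : Type*}
    [∀ i, AddCommGroup (V i)] [∀ i, Module k (V i)] [∀ i, AddCommGroup (W i)]
    [∀ i, Module k (W i)] [AddCommGroup Z] [Module k Z]
    {f g : MultilinearMap k (fun i => V i ⊗[k] W i) Z}
    (h : ∀ (v : ∀ i, V i) (w : ∀ i, W i), f (fun i => v i ⊗ₜ[k] w i) = g (fun i => v i ⊗ₜ[k] w i)) : f = g := by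
  ext1 t
  refine pi_additive_induction (S := fun i => {t | ∃ v w, t = v ⊗ₜ[k] w})
    (fun i => pure_tensor_closure (V i) (W i)) (C := fun t => f t = g t) ?_ ?_ ?_ t
  · intro t ht
    choose v w ht using ht
    obtain rfl : t = fun i => v i ⊗ₜ[k] w i := funext ht
    exact h v w
  · intro t i
    simp only [MultilinearMap.map_update_zero]
  · intro t i a b ha hb
    rw [MultilinearMap.map_update_add, MultilinearMap.map_update_add, ha, hb]

lemma exists_box : ∀ {n : ℕ} {V W : Fin n → Type*} {V' W' : Type*}
    [∀ i, AddCommGroup (V i)] [∀ i, Module k (V i)] [∀ i, AddCommGroup (W i)]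
    [∀ i, Module k (W i)] [AddCommGroup V'] [Module k V'] [AddCommGroup W'] [Module k W']
    (f : MultilinearMap k V V') (g : MultilinearMap k W W'),
    ∃ h : MultilinearMap k (fun i => V i ⊗[k] W i) (V' ⊗[k] W'),
      ∀ (v : ∀ i, V i) (w : ∀ i, W i), h (fun i => v i ⊗ₜ[k] w i) = f v ⊗ₜ[k] g w := by
  intro n
  induction n with
  | zero =>
    intro V W V' W' _ _ _ _ _ _ _ _ f g
    refine ⟨MultilinearMap.constOfIsEmpty k _ (f (fun i => i.elim0) ⊗ₜ[k] g fun i => i.elim0),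
      fun v w => ?_⟩
    rw [MultilinearMap.constOfIsEmpty_apply]
    rw [show v = fun i => i.elim0 from funext fun i => i.elim0,
      show w = fun i => i.elim0 from funext fun i => i.elim0]
    rfl
  | succ n ih =>
    intro V W V' W' _ _ _ _ _ _ _ _ f g
    choose h hh using fun (v : V 0) (w : W 0) => ih (f.curryLeft v) (g.curryLeft w)
    let L : V 0 ⊗[k] W 0 →ₗ[k]
        MultilinearMap k (fun i : Fin n => V i.succ ⊗[k] W i.succ) (V' ⊗[k] W') :=
      TensorProduct.lift (LinearMap.mk₂ k h
        (fun a b c => multilinear_ext_pure fun v w => by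
          simp only [_root_.add_apply, hh, map_add, TensorProduct.add_tmul])
        (fun r a b => multilinear_ext_pure fun v w => by
          simp only [_root_.smul_apply, hh, map_smul, TensorProduct.smul_tmul'])
        (fun a b c => multilinear_ext_pure fun v w => by
          simp only [_root_.add_apply, hh, map_add, TensorProduct.tmul_add])
        (fun r a b => multilinear_ext_pure fun v w => by
          simp only [_root_.smul_apply, hh, map_smul, TensorProduct.tmul_smul]))
    refine ⟨LinearMap.uncurryLeft (M := fun i => V i ⊗[k] W i) L, fun v w => ?_⟩
    rw [LinearMap.uncurryLeft_apply]
    show L (v 0 ⊗ₜ[k] w 0) (fun i : Fin n => v i.succ ⊗ₜ[k] w i.succ) = _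
    have hL : L (v 0 ⊗ₜ[k] w 0) = h (v 0) (w 0) := by
      simp only [L, TensorProduct.lift.tmul, LinearMap.mk₂_apply]
    rw [hL, hh, MultilinearMap.curryLeft_apply, MultilinearMap.curryLeft_apply]
    congr 2 <;> exact Fin.cons_self_tail _

/-- The tensor product of two multilinear maps `f` and `g`: the unique multilinear map with
`(vᵢ ⊗ wᵢ)ᵢ ↦ f(v₁, …, vₙ) ⊗ g(w₁, …, wₙ)`. -/
def box {n : ℕ} {V W : Fin n → Type*} {V' W' : Type*}
    [∀ i, AddCommGroup (V i)] [∀ i, Module k (V i)] [∀ i, AddCommGroup (W i)]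
    [∀ i, Module k (W i)] [AddCommGroup V'] [Module k V'] [AddCommGroup W'] [Module k W']
    (f : MultilinearMap k V V') (g : MultilinearMap k W W') :
    MultilinearMap k (fun i => V i ⊗[k] W i) (V' ⊗[k] W') :=
  (exists_box f g).choose

lemma box_tmul {n : ℕ} {V W : Fin n → Type*} {V' W' : Type*}
    [∀ i, AddCommGroup (V i)] [∀ i, Module k (V i)] [∀ i, AddCommGroup (W i)]
    [∀ i, Module k (W i)] [AddCommGroup V'] [Module k V'] [AddCommGroup W'] [Module k W']
    (f : MultilinearMap k V V') (g : MultilinearMap k W W') (v : ∀ i, V i) (w : ∀ i, W i) :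
    box f g (fun i => v i ⊗ₜ[k] w i) = f v ⊗ₜ[k] g w :=
  (exists_box f g).choose_spec v w

/-- For families of multilinear maps `F x`, `G y` depending linearly on `x ∈ X`, `y ∈ Y`, the
family of multilinear maps, linear in `X ⊗ Y`, with
`boxLin F G (x ⊗ y) (vᵢ ⊗ wᵢ)ᵢ = F x (vᵢ)ᵢ ⊗ G y (wᵢ)ᵢ`. -/
def boxLin {n : ℕ} {X Y : Type*} {V W : Fin n → Type*} {V' W' : Type*}
    [AddCommGroup X] [Module k X] [AddCommGroup Y] [Module k Y]
    [∀ i, AddCommGroup (V i)] [∀ i, Module k (V i)] [∀ i, AddCommGroup (W i)]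
    [∀ i, Module k (W i)] [AddCommGroup V'] [Module k V'] [AddCommGroup W'] [Module k W']
    (F : X →ₗ[k] MultilinearMap k V V') (G : Y →ₗ[k] MultilinearMap k W W') :
    X ⊗[k] Y →ₗ[k] MultilinearMap k (fun i => V i ⊗[k] W i) (V' ⊗[k] W') :=
  TensorProduct.lift (LinearMap.mk₂ k (fun x y => box (F x) (G y))
    (fun a b c => multilinear_ext_pure fun v w => by
      simp only [_root_.add_apply, box_tmul, map_add, TensorProduct.add_tmul])
    (fun r a b => multilinear_ext_pure fun v w => by
      simp only [_root_.smul_apply, box_tmul, map_smul, TensorProduct.smul_tmul'])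
    (fun a b c => multilinear_ext_pure fun v w => by
      simp only [_root_.add_apply, box_tmul, map_add, TensorProduct.tmul_add])
    (fun r a b => multilinear_ext_pure fun v w => by
      simp only [_root_.smul_apply, box_tmul, map_smul, TensorProduct.tmul_smul]))

lemma boxLin_tmul {n : ℕ} {X Y : Type*} {V W : Fin n → Type*} {V' W' : Type*}
    [AddCommGroup X] [Module k X] [AddCommGroup Y] [Module k Y]
    [∀ i, AddCommGroup (V i)] [∀ i, Module k (V i)] [∀ i, AddCommGroup (W i)]
    [∀ i, Module k (W i)] [AddCommGroup V'] [Module k V'] [AddCommGroup W'] [Module k W']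
    (F : X →ₗ[k] MultilinearMap k V V') (G : Y →ₗ[k] MultilinearMap k W W') (x : X) (y : Y)
    (v : ∀ i, V i) (w : ∀ i, W i) :
    boxLin F G (x ⊗ₜ[k] y) (fun i => v i ⊗ₜ[k] w i) = F x v ⊗ₜ[k] G y w := by
  rw [boxLin, TensorProduct.lift.tmul, LinearMap.mk₂_apply, box_tmul]

/-- Two expressions `F(t)`, `G(t)`, additive in `x ∈ X ⊗ Y` and in each entry `yᵢ`, `z_{i,j}` of
families of tensors, agree as soon as they agree on pure tensors. -/
lemma pure_induction {ι : Type*} [Finite ι] [DecidableEq ι] {V W : ι → Type*} {Z : Type*}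
    [∀ i, AddCommGroup (V i)] [∀ i, Module k (V i)] [∀ i, AddCommGroup (W i)]
    [∀ i, Module k (W i)] [AddCommGroup Z]
    (f g : (∀ i, V i ⊗[k] W i) → Z)
    (hf : ∀ t i a b, f (Function.update t i (a + b)) =
      f (Function.update t i a) + f (Function.update t i b))
    (hg : ∀ t i a b, g (Function.update t i (a + b)) =
      g (Function.update t i a) + g (Function.update t i b))
    (h : ∀ (v : ∀ i, V i) (w : ∀ i, W i), f (fun i => v i ⊗ₜ[k] w i) = g (fun i => v i ⊗ₜ[k] w i))
    (t : ∀ i, V i ⊗[k] W i) : f t = g t := by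
  refine pi_additive_induction (S := fun i => {t | ∃ v w, t = v ⊗ₜ[k] w})
    (fun i => pure_tensor_closure (V i) (W i)) (C := fun t => f t = g t) ?_ ?_ ?_ t
  · intro t ht
    choose v w ht using ht
    obtain rfl : t = fun i => v i ⊗ₜ[k] w i := funext ht
    exact h v w
  · intro t i
    have h1 := hf t i 0 0
    have h2 := hg t i 0 0
    rw [add_zero] at h1 h2
    rw [left_eq_add.1 h1, left_eq_add.1 h2]
  · intro t i a b ha hb
    rw [hf, hg, ha, hb]

/-- A multilinear map applied to a family of multilinear maps in blocks of variables is additive in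
each variable. -/
lemma comp_blocks_add {n : ℕ} {m : Fin n → ℕ} {U : Fin n → Type*} {U' : Type*}
    {V : Fin (∑ i, m i) → Type*}
    [∀ i, AddCommMonoid (U i)] [∀ i, Module k (U i)] [AddCommMonoid U'] [Module k U']
    [∀ p, AddCommMonoid (V p)] [∀ p, Module k (V p)]
    (F : MultilinearMap k U U')
    (G : ∀ i, MultilinearMap k (fun j : Fin (m i) => V (finSigmaFinEquiv ⟨i, j⟩)) (U i))
    (t : ∀ p, V p) (p : Fin (∑ i, m i)) (a b : V p) :
    F (fun i => G i fun j => Function.update t p (a + b) (finSigmaFinEquiv ⟨i, j⟩)) =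
      F (fun i => G i fun j => Function.update t p a (finSigmaFinEquiv ⟨i, j⟩)) +
      F (fun i => G i fun j => Function.update t p b (finSigmaFinEquiv ⟨i, j⟩)) := by
  obtain ⟨⟨i₀, j₀⟩, rfl⟩ := finSigmaFinEquiv.surjective p
  have h : ∀ c, (fun i => G i fun j =>
      Function.update t (finSigmaFinEquiv ⟨i₀, j₀⟩) c (finSigmaFinEquiv ⟨i, j⟩)) =
      Function.update (fun i => G i fun j => t (finSigmaFinEquiv ⟨i, j⟩)) i₀
        (G i₀ (Function.update (fun j => t (finSigmaFinEquiv ⟨i₀, j⟩)) j₀ c)) := by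
    intro c
    funext i
    by_cases hi : i = i₀
    · subst hi
      rw [Function.update_self]
      congr 1
      funext j
      by_cases hj : j = j₀
      · subst hj; simp
      · rw [Function.update_of_ne hj, Function.update_of_ne]
        simpa using hj
    · rw [Function.update_of_ne hi]
      congr 1
      funext j
      rw [Function.update_of_ne]
      intro hcon
      exact hi (congrArg Sigma.fst (finSigmaFinEquiv.injective hcon))
  rw [h, h, h, MultilinearMap.map_update_add, MultilinearMap.map_update_add]

lemma update_comp_apply {n : ℕ} {U V : Fin n → Type*} (G : ∀ i, U i → V i) (t : ∀ i, U i)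
    (i : Fin n) (c : U i) :
    (fun j => G j (Function.update t i c j)) =
      Function.update (fun j => G j (t j)) i (G i c) := by
  funext j
  exact Function.apply_update G t i c j

end Box

namespace Operad

variable {k : Type u} [Field k]

/-- The Hadamard product of operads: `(P ⊗ Q)(n) = P(n) ⊗ Q(n)` with componentwise composition
and symmetric group action. -/
def hadamard (P : Operad.{u, v} k) (Q : Operad.{u, w} k) : Operad.{u, max v w} k where
  Op n := P.Op n ⊗[k] Q.Op n
  subsingleton_zero := by
    have := P.subsingleton_zero
    exact inferInstance
  map e := TensorProduct.map (P.map e) (Q.map e)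
  map_refl {n} x := by
    have h1 : P.map (Equiv.refl (Fin n)) = LinearMap.id := LinearMap.ext P.map_refl
    have h2 : Q.map (Equiv.refl (Fin n)) = LinearMap.id := LinearMap.ext Q.map_refl
    rw [h1, h2, TensorProduct.map_id, LinearMap.id_apply]
  map_trans e e' x := by
    have h1 : P.map (e.trans e') = P.map e' ∘ₗ P.map e := LinearMap.ext (P.map_trans e e')
    have h2 : Q.map (e.trans e') = Q.map e' ∘ₗ Q.map e := LinearMap.ext (Q.map_trans e e')
    rw [h1, h2, TensorProduct.map_comp, LinearMap.comp_apply]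
  one := P.one ⊗ₜ[k] Q.one
  comp m := boxLin (P.comp m) (Q.comp m)
  one_comp {n} x := by
    induction x using TensorProduct.induction_on with
    | zero =>
      rw [map_zero]
      exact MultilinearMap.map_coord_zero _ 0 rfl
    | tmul x y =>
      rw [boxLin_tmul (V := fun _ => P.Op n) (W := fun _ => Q.Op n), P.one_comp, Q.one_comp,
        TensorProduct.map_tmul]
    | add a b ha hb =>
      rw [map_add, ← ha, ← hb]
      have h : ∀ c : P.Op n ⊗[k] Q.Op n, (fun _ : Fin 1 => c) =
          Function.update (fun _ : Fin 1 => c) 0 c := by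
        intro c; simp
      have h' : ∀ c d : P.Op n ⊗[k] Q.Op n, Function.update (fun _ : Fin 1 => c) 0 d =
          fun _ : Fin 1 => d := by
        intro c d; funext i; rw [Subsingleton.elim i 0]; simp
      conv_lhs => rw [h (a + b)]
      rw [MultilinearMap.map_update_add, h', h']
  comp_one {n} x := by
    induction x using TensorProduct.induction_on with
    | zero => simp
    | tmul x y =>
      rw [boxLin_tmul (V := fun _ => P.Op 1) (W := fun _ => Q.Op 1), P.comp_one, Q.comp_one,
        TensorProduct.map_tmul]
    | add a b ha hb => rw [map_add, _root_.add_apply, ha, hb, map_add]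
  comp_assoc {n} m l x y z := by
    induction x using TensorProduct.induction_on with
    | zero => simp
    | add a b ha hb => simp only [map_add, _root_.add_apply, ha, hb]
    | tmul x x' =>
      refine pure_induction (V := fun i => P.Op (m i)) (W := fun i => Q.Op (m i))
        (f := fun y => boxLin (P.comp l) (Q.comp l)
          (boxLin (P.comp m) (Q.comp m) (x ⊗ₜ[k] x') y) z)
        (g := fun y => TensorProduct.map (P.map (assocEquiv m l)) (Q.map (assocEquiv m l))
          (boxLin (P.comp fun i => ∑ j, l (finSigmaFinEquiv ⟨i, j⟩))
            (Q.comp fun i => ∑ j, l (finSigmaFinEquiv ⟨i, j⟩)) (x ⊗ₜ[k] x')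
            (fun i => boxLin (P.comp fun j => l (finSigmaFinEquiv ⟨i, j⟩))
              (Q.comp fun j => l (finSigmaFinEquiv ⟨i, j⟩)) (y i)
              (fun j => z (finSigmaFinEquiv ⟨i, j⟩))))) ?_ ?_ ?_ y
      · intro t i a b
        simp only [MultilinearMap.map_update_add, map_add, _root_.add_apply]
      · intro t i a b
        have h := fun c => update_comp_apply
          (fun i (w : P.Op (m i) ⊗[k] Q.Op (m i)) =>
            boxLin (P.comp fun j => l (finSigmaFinEquiv ⟨i, j⟩))
              (Q.comp fun j => l (finSigmaFinEquiv ⟨i, j⟩)) w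
              (fun j => z (finSigmaFinEquiv ⟨i, j⟩))) t i c
        simp only [h, MultilinearMap.map_update_add, map_add, _root_.add_apply]
      · intro y y'
        refine pure_induction (V := fun i => P.Op (l i)) (W := fun i => Q.Op (l i))
          (f := fun z => boxLin (P.comp l) (Q.comp l)
            (boxLin (P.comp m) (Q.comp m) (x ⊗ₜ[k] x') fun i => y i ⊗ₜ[k] y' i) z)
          (g := fun z => TensorProduct.map (P.map (assocEquiv m l)) (Q.map (assocEquiv m l))
            (boxLin (P.comp fun i => ∑ j, l (finSigmaFinEquiv ⟨i, j⟩))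
              (Q.comp fun i => ∑ j, l (finSigmaFinEquiv ⟨i, j⟩)) (x ⊗ₜ[k] x')
              (fun i => boxLin (P.comp fun j => l (finSigmaFinEquiv ⟨i, j⟩))
                (Q.comp fun j => l (finSigmaFinEquiv ⟨i, j⟩)) (y i ⊗ₜ[k] y' i)
                (fun j => z (finSigmaFinEquiv ⟨i, j⟩))))) ?_ ?_ ?_ z
        · intro t i a b
          simp only [MultilinearMap.map_update_add]
        · intro t p a b
          rw [← map_add]
          congr 1
          exact comp_blocks_add (k := k) (V := fun p => P.Op (l p) ⊗[k] Q.Op (l p))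
            (U := fun i => P.Op (∑ j, l (finSigmaFinEquiv ⟨i, j⟩)) ⊗[k]
              Q.Op (∑ j, l (finSigmaFinEquiv ⟨i, j⟩)))
            (boxLin (P.comp fun i => ∑ j, l (finSigmaFinEquiv ⟨i, j⟩))
              (Q.comp fun i => ∑ j, l (finSigmaFinEquiv ⟨i, j⟩)) (x ⊗ₜ[k] x'))
            (fun i => boxLin (P.comp fun j => l (finSigmaFinEquiv ⟨i, j⟩))
              (Q.comp fun j => l (finSigmaFinEquiv ⟨i, j⟩)) (y i ⊗ₜ[k] y' i)) t p a b
        · intro z z'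
          simp only [boxLin_tmul, TensorProduct.map_tmul, P.comp_assoc m l, Q.comp_assoc m l]
  comp_map_right m m' τ x y := by
    induction x using TensorProduct.induction_on with
    | zero => simp
    | add a b ha hb => simp only [map_add, _root_.add_apply, ha, hb]
    | tmul x x' =>
      refine pure_induction (V := fun i => P.Op (m i)) (W := fun i => Q.Op (m i))
        (f := fun y => boxLin (P.comp m') (Q.comp m') (x ⊗ₜ[k] x')
          fun i => TensorProduct.map (P.map (τ i)) (Q.map (τ i)) (y i))
        (g := fun y => TensorProduct.map (P.map (innerEquiv τ)) (Q.map (innerEquiv τ))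
          (boxLin (P.comp m) (Q.comp m) (x ⊗ₜ[k] x') y)) ?_ ?_ ?_ y
      · intro t i a b
        have h := fun c => update_comp_apply
          (fun i (w : P.Op (m i) ⊗[k] Q.Op (m i)) =>
            TensorProduct.map (P.map (τ i)) (Q.map (τ i)) w) t i c
        simp only [h, MultilinearMap.map_update_add, map_add]
      · intro t i a b
        simp only [MultilinearMap.map_update_add, map_add]
      · intro y y'
        simp only [boxLin_tmul, TensorProduct.map_tmul, P.comp_map_right, Q.comp_map_right]
  comp_map_left {n n'} σ m x y := by
    induction x using TensorProduct.induction_on with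
    | zero => simp
    | add a b ha hb => simp only [map_add, _root_.add_apply, ha, hb]
    | tmul x x' =>
      refine pure_induction (V := fun i => P.Op (m i)) (W := fun i => Q.Op (m i))
        (f := fun y => boxLin (P.comp m) (Q.comp m)
          (TensorProduct.map (P.map σ) (Q.map σ) (x ⊗ₜ[k] x')) y)
        (g := fun y => TensorProduct.map (P.map (outerEquiv σ m)) (Q.map (outerEquiv σ m))
          (boxLin (P.comp fun i => m (σ i)) (Q.comp fun i => m (σ i)) (x ⊗ₜ[k] x')
            fun i => y (σ i))) ?_ ?_ ?_ y
      · intro t i a b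
        simp only [MultilinearMap.map_update_add]
      · intro t i a b
        obtain ⟨i, rfl⟩ := σ.surjective i
        have h : ∀ c, (fun j => Function.update t (σ i) c (σ j)) =
            Function.update (fun j => t (σ j)) i c := by
          intro c
          funext j
          by_cases hj : j = i
          · subst hj; simp
          · rw [Function.update_of_ne hj, Function.update_of_ne (σ.injective.ne hj)]
        simp only [h, MultilinearMap.map_update_add, map_add]
      · intro y y'
        simp only [boxLin_tmul, TensorProduct.map_tmul, P.comp_map_left, Q.comp_map_left]

end Operad

namespace Operad

variable {k : Type u} [Field k]

lemma idTensor_map_map (C : Operad.{u, t} k) {N : Operad.{u, v} k} {M : Operad.{u, w} k}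
    (ω : N.Hom M) {m n : ℕ} (e : Fin m ≃ Fin n) (x : C.Op m ⊗[k] N.Op m) :
    TensorProduct.map LinearMap.id (ω.toFun n) (TensorProduct.map (C.map e) (N.map e) x) =
      TensorProduct.map (C.map e) (M.map e) (TensorProduct.map LinearMap.id (ω.toFun m) x) := by
  induction x using TensorProduct.induction_on with
  | zero => simp
  | add a b ha hb => simp only [map_add, ha, hb]
  | tmul x y => simp only [TensorProduct.map_tmul, LinearMap.id_apply, ω.map_map]

lemma idTensor_map_comp (C : Operad.{u, t} k) {N : Operad.{u, v} k} {M : Operad.{u, w} k}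
    (ω : N.Hom M) {n : ℕ} (m : Fin n → ℕ) (x : C.Op n ⊗[k] N.Op n)
    (y : ∀ i, C.Op (m i) ⊗[k] N.Op (m i)) :
    TensorProduct.map LinearMap.id (ω.toFun _) (boxLin (C.comp m) (N.comp m) x y) =
      boxLin (C.comp m) (M.comp m) (TensorProduct.map LinearMap.id (ω.toFun n) x)
          fun i => TensorProduct.map LinearMap.id (ω.toFun (m i)) (y i) := by
  induction x using TensorProduct.induction_on with
  | zero => simp
  | add a b ha hb => simp only [map_add, _root_.add_apply, ha, hb]
  | tmul x x' =>
    refine pure_induction (V := fun i => C.Op (m i)) (W := fun i => N.Op (m i))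
      (f := fun y => TensorProduct.map LinearMap.id (ω.toFun _)
        (boxLin (C.comp m) (N.comp m) (x ⊗ₜ[k] x') y))
      (g := fun y => boxLin (C.comp m) (M.comp m)
        (TensorProduct.map LinearMap.id (ω.toFun n) (x ⊗ₜ[k] x'))
        fun i => TensorProduct.map LinearMap.id (ω.toFun (m i)) (y i)) ?_ ?_ ?_ y
    · intro t i a b
      simp only [MultilinearMap.map_update_add, map_add]
    · intro t i a b
      have h := fun c => update_comp_apply
        (fun i (w : C.Op (m i) ⊗[k] N.Op (m i)) =>
          TensorProduct.map (LinearMap.id : C.Op (m i) →ₗ[k] _) (ω.toFun (m i)) w) t i c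
      simp only [h, MultilinearMap.map_update_add, map_add]
    · intro y y'
      simp only [boxLin_tmul, TensorProduct.map_tmul, LinearMap.id_apply, ω.map_comp]

/-- The morphism `id ⊗ ω : C ⊗ N → C ⊗ M` induced by a morphism `ω : N → M`. -/
def Hom.idTensor (C : Operad.{u, t} k) {N : Operad.{u, v} k} {M : Operad.{u, w} k}
    (ω : N.Hom M) : (C.hadamard N).Hom (C.hadamard M) where
  toFun n := TensorProduct.map LinearMap.id (ω.toFun n)
  map_map e x := idTensor_map_map C ω e x
  map_one := by
    show TensorProduct.map LinearMap.id (ω.toFun 1) (C.one ⊗ₜ[k] N.one) = C.one ⊗ₜ[k] M.one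
    rw [TensorProduct.map_tmul, LinearMap.id_apply, ω.map_one]
  map_comp m x y := idTensor_map_comp C ω m x y

lemma tensor_act_map {P : Operad.{u, v} k} {Q : Operad.{u, w} k} (A : P.Algebra)
    (B : Q.Algebra) {m n : ℕ} (e : Fin m ≃ Fin n) (x : P.Op m ⊗[k] Q.Op m)
    (a : Fin n → A.carrier ⊗[k] B.carrier) :
    boxLin (V := fun _ => A.carrier) (W := fun _ => B.carrier) A.act B.act (TensorProduct.map (P.map e) (Q.map e) x) a =
      boxLin (V := fun _ => A.carrier) (W := fun _ => B.carrier) A.act B.act x fun i => a (e i) := by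
  induction x using TensorProduct.induction_on with
  | zero => simp
  | add a b ha hb => simp only [map_add, _root_.add_apply, ha, hb]
  | tmul x x' =>
    refine pure_induction (V := fun _ => A.carrier) (W := fun _ => B.carrier)
      (f := fun a => boxLin A.act B.act (TensorProduct.map (P.map e) (Q.map e) (x ⊗ₜ[k] x')) a)
      (g := fun a => boxLin A.act B.act (x ⊗ₜ[k] x') fun i => a (e i)) ?_ ?_ ?_ a
    · intro t i a b
      simp only [MultilinearMap.map_update_add]
    · intro t i a b
      obtain ⟨i, rfl⟩ := e.surjective i
      have h : ∀ c, (fun j => Function.update t (e i) c (e j)) =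
          Function.update (fun j => t (e j)) i c := by
        intro c
        funext j
        by_cases hj : j = i
        · subst hj; simp
        · rw [Function.update_of_ne hj, Function.update_of_ne (e.injective.ne hj)]
      simp only [h, MultilinearMap.map_update_add]
    · intro a b
      rw [TensorProduct.map_tmul, boxLin_tmul (V := fun _ => A.carrier)
        (W := fun _ => B.carrier), boxLin_tmul (V := fun _ => A.carrier)
        (W := fun _ => B.carrier), A.act_map, B.act_map]

lemma tensor_act_comp {P : Operad.{u, v} k} {Q : Operad.{u, w} k} (A : P.Algebra)
    (B : Q.Algebra) {n : ℕ} (m : Fin n → ℕ) (x : P.Op n ⊗[k] Q.Op n)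
    (y : ∀ i, P.Op (m i) ⊗[k] Q.Op (m i)) (a : Fin (∑ i, m i) → A.carrier ⊗[k] B.carrier) :
    boxLin (V := fun _ => A.carrier) (W := fun _ => B.carrier) A.act B.act
        (boxLin (P.comp m) (Q.comp m) x y) a =
      boxLin (V := fun _ => A.carrier) (W := fun _ => B.carrier) A.act B.act x fun i =>
        boxLin (V := fun _ => A.carrier) (W := fun _ => B.carrier) A.act B.act (y i)
          fun j => a (finSigmaFinEquiv ⟨i, j⟩) := by
  induction x using TensorProduct.induction_on with
  | zero =>
    simp
  | add a b ha hb => simp only [map_add, _root_.add_apply, ha, hb]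
  | tmul x x' =>
    refine pure_induction (V := fun i => P.Op (m i)) (W := fun i => Q.Op (m i))
      (f := fun y => boxLin (V := fun _ => A.carrier) (W := fun _ => B.carrier) A.act B.act
        (boxLin (P.comp m) (Q.comp m) (x ⊗ₜ[k] x') y) a)
      (g := fun y => boxLin A.act B.act (x ⊗ₜ[k] x') fun i =>
        boxLin (V := fun _ => A.carrier) (W := fun _ => B.carrier) A.act B.act (y i)
          fun j => a (finSigmaFinEquiv ⟨i, j⟩)) ?_ ?_ ?_ y
    · intro t i a b
      simp only [MultilinearMap.map_update_add, map_add, _root_.add_apply]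
    · intro t i c d
      have h := fun c => update_comp_apply
        (fun i (w : P.Op (m i) ⊗[k] Q.Op (m i)) =>
          boxLin (V := fun _ => A.carrier) (W := fun _ => B.carrier) A.act B.act w
            (fun j => a (finSigmaFinEquiv ⟨i, j⟩))) t i c
      simp only [h, MultilinearMap.map_update_add, map_add, _root_.add_apply]
    · intro y y'
      refine pure_induction (V := fun _ => A.carrier) (W := fun _ => B.carrier)
        (f := fun a => boxLin (V := fun _ => A.carrier) (W := fun _ => B.carrier) A.act B.act
          (boxLin (P.comp m) (Q.comp m) (x ⊗ₜ[k] x') fun i => y i ⊗ₜ[k] y' i) a)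
        (g := fun a => boxLin A.act B.act (x ⊗ₜ[k] x') fun i =>
          boxLin (V := fun _ => A.carrier) (W := fun _ => B.carrier) A.act B.act
            (y i ⊗ₜ[k] y' i) fun j => a (finSigmaFinEquiv ⟨i, j⟩)) ?_ ?_ ?_ a
      · intro t i a b
        simp only [MultilinearMap.map_update_add]
      · intro t p a b
        exact comp_blocks_add (k := k) (V := fun _ => A.carrier ⊗[k] B.carrier)
          (U := fun _ => A.carrier ⊗[k] B.carrier)
          (boxLin (V := fun _ => A.carrier) (W := fun _ => B.carrier) A.act B.act (x ⊗ₜ[k] x'))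
          (fun i => boxLin (V := fun _ => A.carrier) (W := fun _ => B.carrier) A.act B.act
            (y i ⊗ₜ[k] y' i)) t p a b
      · intro a b
        simp only [boxLin_tmul, A.act_comp, B.act_comp]

/-- For a `P`-algebra `A` and a `Q`-algebra `B`, the space `A ⊗ B` is a `P ⊗ Q`-algebra with
`(x ⊗ y)(a₁ ⊗ b₁, …, aₙ ⊗ bₙ) = x(a₁, …, aₙ) ⊗ y(b₁, …, bₙ)`. -/
def Algebra.tensor {P : Operad.{u, v} k} {Q : Operad.{u, w} k} (A : P.Algebra) (B : Q.Algebra) :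
    (P.hadamard Q).Algebra where
  carrier := A.carrier ⊗[k] B.carrier
  act := boxLin A.act B.act
  act_one a := by
    refine pure_induction (V := fun _ => A.carrier) (W := fun _ => B.carrier)
      (f := fun a => boxLin A.act B.act (P.one ⊗ₜ[k] Q.one) a) (g := fun a => a 0) ?_ ?_ ?_ a
    · intro t i a b
      simp only [MultilinearMap.map_update_add]
    · intro t i a b
      rw [Subsingleton.elim i 0]
      simp
    · intro a b
      rw [boxLin_tmul (V := fun _ => A.carrier) (W := fun _ => B.carrier), A.act_one, B.act_one]
  act_map e x a := tensor_act_map A B e x a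
  act_comp m x y a := tensor_act_comp A B m x y a

end Operad

namespace UEnv

variable {k : Type u} [Field k] {N : Operad.{u, t} k} {M : Operad.{u, v} k} (ω : N.Hom M)
  (B : Operad.Algebra.{u, t, w} N)

/-- Formal expressions in the elements of `B`, built with linear combinations and the operations
of `M`. -/
inductive Expr (M : Operad.{u, v} k) (B : Operad.Algebra.{u, t, w} N) : Type (max u v w)
  | of : B.carrier → Expr M B
  | zero : Expr M B
  | add : Expr M B → Expr M B → Expr M B
  | smul : k → Expr M B → Expr M B
  | op : ∀ {n : ℕ}, M.Op n → (Fin n → Expr M B) → Expr M B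

/-- The congruence on formal expressions generated by the axioms of `M`-algebras and by the
relations stating that `B → U^(ω)` is a homomorphism of `N`-algebras. -/
inductive Rel : Expr M B → Expr M B → Prop
  | refl (a) : Rel a a
  | symm {a b} : Rel a b → Rel b a
  | trans {a b c} : Rel a b → Rel b c → Rel a c
  | add_congr {a a' b b'} : Rel a a' → Rel b b' → Rel (.add a b) (.add a' b')
  | smul_congr (c : k) {a a'} : Rel a a' → Rel (.smul c a) (.smul c a')
  | op_congr {n : ℕ} (x : M.Op n) {a a' : Fin n → Expr M B} :
      (∀ i, Rel (a i) (a' i)) → Rel (.op x a) (.op x a')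
  | add_assoc (a b c) : Rel (.add (.add a b) c) (.add a (.add b c))
  | add_comm (a b) : Rel (.add a b) (.add b a)
  | zero_add (a) : Rel (.add .zero a) a
  | neg_add (a) : Rel (.add (.smul (-1) a) a) .zero
  | one_smul (a) : Rel (.smul 1 a) a
  | mul_smul (c d : k) (a) : Rel (.smul (c * d) a) (.smul c (.smul d a))
  | smul_add (c : k) (a b) : Rel (.smul c (.add a b)) (.add (.smul c a) (.smul c b))
  | add_smul (c d : k) (a) : Rel (.smul (c + d) a) (.add (.smul c a) (.smul d a))
  | op_add_left {n : ℕ} (x y : M.Op n) (a) : Rel (.op (x + y) a) (.add (.op x a) (.op y a))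
  | op_smul_left {n : ℕ} (c : k) (x : M.Op n) (a) : Rel (.op (c • x) a) (.smul c (.op x a))
  | op_add {n : ℕ} (x : M.Op n) (a : Fin n → Expr M B) (i : Fin n) (b c : Expr M B) :
      Rel (.op x (Function.update a i (.add b c)))
        (.add (.op x (Function.update a i b)) (.op x (Function.update a i c)))
  | op_smul {n : ℕ} (x : M.Op n) (a : Fin n → Expr M B) (i : Fin n) (r : k) (b : Expr M B) :
      Rel (.op x (Function.update a i (.smul r b))) (.smul r (.op x (Function.update a i b)))
  | op_one (a : Fin 1 → Expr M B) : Rel (.op M.one a) (a 0)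
  | op_map {m n : ℕ} (e : Fin m ≃ Fin n) (x : M.Op m) (a : Fin n → Expr M B) :
      Rel (.op (M.map e x) a) (.op x fun i => a (e i))
  | op_comp {n : ℕ} (m : Fin n → ℕ) (x : M.Op n) (y : ∀ i, M.Op (m i))
      (a : Fin (∑ i, m i) → Expr M B) :
      Rel (.op (M.comp m x y) a)
        (.op x fun i => .op (y i) fun j => a (finSigmaFinEquiv ⟨i, j⟩))
  | of_add (b c : B.carrier) : Rel (.of (b + c)) (.add (.of b) (.of c))
  | of_smul (r : k) (b : B.carrier) : Rel (.of (r • b)) (.smul r (.of b))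
  | of_act {n : ℕ} (x : N.Op n) (b : Fin n → B.carrier) :
      Rel (.of (B.act x b)) (.op (ω.toFun n x) fun i => .of (b i))

/-- `Rel` as an equivalence relation. -/
def setoid : Setoid (Expr M B) := ⟨Rel ω B, Rel.refl, Rel.symm, Rel.trans⟩

/-- The underlying set of the universal enveloping algebra. -/
def Carrier : Type (max u v w) := Quotient (setoid ω B)

variable {B}

/-- The class of a formal expression. -/
def mk (a : Expr M B) : Carrier ω B := Quotient.mk (setoid ω B) a

variable {ω}

lemma mk_surjective (q : Carrier ω B) : ∃ a, mk ω a = q := Quotient.exists_rep q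

lemma mk_eq {a b : Expr M B} (h : Rel ω B a b) : mk ω a = mk ω b :=
  Quotient.sound (s := setoid ω B) h

lemma mk_exact {a b : Expr M B} (h : mk ω a = mk ω b) : Rel ω B a b :=
  Quotient.exact (s := setoid ω B) h

instance : Zero (Carrier ω B) := ⟨mk ω .zero⟩

instance : Add (Carrier ω B) :=
  ⟨Quotient.map₂ Expr.add fun _ _ h _ _ h' => Rel.add_congr h h'⟩

instance : SMul k (Carrier ω B) :=
  ⟨fun c => Quotient.map (Expr.smul c) fun _ _ h => Rel.smul_congr c h⟩

lemma mk_add (a b : Expr M B) : mk ω (.add a b) = mk ω a + mk ω b := rfl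
lemma mk_smul (c : k) (a : Expr M B) : mk ω (.smul c a) = c • mk ω a := rfl
lemma mk_zero : mk ω (.zero : Expr M B) = 0 := rfl

protected lemma zero_add' (a : Carrier ω B) : 0 + a = a := by
  obtain ⟨a, rfl⟩ := mk_surjective a
  exact mk_eq (Rel.zero_add a)

protected lemma add_comm' (a b : Carrier ω B) : a + b = b + a := by
  obtain ⟨a, rfl⟩ := mk_surjective a
  obtain ⟨b, rfl⟩ := mk_surjective b
  exact mk_eq (Rel.add_comm a b)

instance : Neg (Carrier ω B) := ⟨fun a => (-1 : k) • a⟩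

instance : AddCommGroup (Carrier ω B) where
  add_assoc a b c := by
    obtain ⟨a, rfl⟩ := mk_surjective a
    obtain ⟨b, rfl⟩ := mk_surjective b
    obtain ⟨c, rfl⟩ := mk_surjective c
    exact mk_eq (Rel.add_assoc a b c)
  zero_add := UEnv.zero_add'
  add_zero a := by rw [UEnv.add_comm', UEnv.zero_add']
  add_comm := UEnv.add_comm'
  neg_add_cancel a := by
    obtain ⟨a, rfl⟩ := mk_surjective a
    exact mk_eq (Rel.neg_add a)
  nsmul := nsmulRec
  zsmul := zsmulRec

protected lemma smul_add' (c : k) (a b : Carrier ω B) : c • (a + b) = c • a + c • b := by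
  obtain ⟨a, rfl⟩ := mk_surjective a
  obtain ⟨b, rfl⟩ := mk_surjective b
  exact mk_eq (Rel.smul_add c a b)

protected lemma add_smul' (c d : k) (a : Carrier ω B) : (c + d) • a = c • a + d • a := by
  obtain ⟨a, rfl⟩ := mk_surjective a
  exact mk_eq (Rel.add_smul c d a)

instance : Module k (Carrier ω B) where
  one_smul a := by
    obtain ⟨a, rfl⟩ := mk_surjective a
    exact mk_eq (Rel.one_smul a)
  mul_smul c d a := by
    obtain ⟨a, rfl⟩ := mk_surjective a
    exact mk_eq (Rel.mul_smul c d a)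
  smul_add := UEnv.smul_add'
  smul_zero c := by
    have h := UEnv.smul_add' c (0 : Carrier ω B) 0
    rw [add_zero] at h
    exact left_eq_add.1 h
  add_smul := UEnv.add_smul'
  zero_smul a := by
    have h := UEnv.add_smul' (0 : k) 0 a
    rw [add_zero] at h
    exact left_eq_add.1 h

/-- The action of an operation on the classes of formal expressions. -/
def opFun {n : ℕ} (x : M.Op n) (a : Fin n → Carrier ω B) : Carrier ω B :=
  mk ω (.op x fun i => (mk_surjective (a i)).choose)

lemma opFun_mk {n : ℕ} (x : M.Op n) (a : Fin n → Expr M B) :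
    opFun x (fun i => mk ω (a i)) = mk ω (.op x a) :=
  mk_eq (Rel.op_congr x fun i => mk_exact (mk_surjective (mk ω (a i))).choose_spec)

lemma mk_update {n : ℕ} (a : Fin n → Expr M B) (i : Fin n) (b : Expr M B) :
    Function.update (fun j => mk ω (a j)) i (mk ω b) =
      fun j => mk ω (Function.update a i b j) := by
  funext j
  exact (Function.apply_update (fun _ => mk ω) a i b j).symm

lemma exists_rep {n : ℕ} (a : Fin n → Carrier ω B) :
    ∃ a' : Fin n → Expr M B, a = fun i => mk ω (a' i) := by
  choose a' ha using fun i => mk_surjective (a i)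
  exact ⟨a', funext fun i => (ha i).symm⟩

/-- The multilinear action of an operation on the universal enveloping algebra. -/
def opMultilinear {n : ℕ} (x : M.Op n) :
    MultilinearMap k (fun _ : Fin n => Carrier ω B) (Carrier ω B) :=
  MultilinearMap.mk' (opFun x)
    (by
      intro a i b c
      obtain ⟨a, rfl⟩ := exists_rep a
      obtain ⟨b, rfl⟩ := mk_surjective b
      obtain ⟨c, rfl⟩ := mk_surjective c
      rw [← mk_add, mk_update, mk_update, mk_update, opFun_mk, opFun_mk, opFun_mk]
      exact mk_eq (Rel.op_add x a i b c))
    (by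
      intro a i r b
      obtain ⟨a, rfl⟩ := exists_rep a
      obtain ⟨b, rfl⟩ := mk_surjective b
      rw [← mk_smul, mk_update, mk_update, opFun_mk, opFun_mk]
      exact mk_eq (Rel.op_smul x a i r b))

lemma opMultilinear_mk {n : ℕ} (x : M.Op n) (a : Fin n → Expr M B) :
    opMultilinear x (fun i => mk ω (a i)) = mk ω (.op x a) := opFun_mk x a

end UEnv

/-- The universal enveloping algebra `U_ω(B)` of the `N`-algebra `B` with respect to `ω : N → M`:
the `M`-algebra generated by the linear space `B` subject to the relations stating that the
operations of `N` act on `B` through `ω`. -/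
def UEnv {k : Type u} [Field k] {N : Operad.{u, t} k} {M : Operad.{u, v} k} (ω : N.Hom M)
    (B : Operad.Algebra.{u, t, w} N) : Operad.Algebra.{u, v, max u v w} M where
  carrier := UEnv.Carrier ω B
  act :=
    { toFun := UEnv.opMultilinear
      map_add' := by
        intro x y
        ext1 a
        obtain ⟨a, rfl⟩ := UEnv.exists_rep a
        rw [_root_.add_apply, UEnv.opMultilinear_mk, UEnv.opMultilinear_mk,
          UEnv.opMultilinear_mk]
        exact UEnv.mk_eq (UEnv.Rel.op_add_left x y a)
      map_smul' := by
        intro c x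
        ext1 a
        obtain ⟨a, rfl⟩ := UEnv.exists_rep a
        rw [RingHom.id_apply, _root_.smul_apply, UEnv.opMultilinear_mk, UEnv.opMultilinear_mk]
        exact UEnv.mk_eq (UEnv.Rel.op_smul_left c x a) }
  act_one a := by
    obtain ⟨a, rfl⟩ := UEnv.exists_rep a
    exact (UEnv.opMultilinear_mk _ a).trans (UEnv.mk_eq (UEnv.Rel.op_one a))
  act_map e x a := by
    obtain ⟨a, rfl⟩ := UEnv.exists_rep a
    exact (UEnv.opMultilinear_mk _ a).trans ((UEnv.mk_eq (UEnv.Rel.op_map e x a)).trans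
      (UEnv.opMultilinear_mk _ _).symm)
  act_comp m x y a := by
    obtain ⟨a, rfl⟩ := UEnv.exists_rep a
    show UEnv.opMultilinear _ _ = UEnv.opMultilinear _ fun i => UEnv.opMultilinear _ _
    simp only [UEnv.opMultilinear_mk]
    exact UEnv.mk_eq (UEnv.Rel.op_comp m x y a)

namespace UEnv

variable {k : Type u} [Field k] {N : Operad.{u, t} k} {M : Operad.{u, v} k} (ω : N.Hom M)
  (B : Operad.Algebra.{u, t, w} N)

/-- The canonical homomorphism `ι : B → U_ω(B)^(ω)`. -/
def ι : B.Hom ((UEnv ω B).restrict ω) where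
  toLin :=
    { toFun := fun b => mk ω (.of b)
      map_add' := fun b c => mk_eq (Rel.of_add b c)
      map_smul' := fun r b => mk_eq (Rel.of_smul r b) }
  map_act x b := (mk_eq (Rel.of_act x b)).trans (opMultilinear_mk _ _).symm

variable {ω B}

/-- The value of a formal expression under a homomorphism `B → A^(ω)`. -/
def eval {A : M.Algebra} (ψ : B.Hom (A.restrict ω)) : Expr M B → A.carrier
  | .of b => ψ.toLin b
  | .zero => 0
  | .add a b => eval ψ a + eval ψ b
  | .smul c a => c • eval ψ a
  | .op x a => A.act x fun i => eval ψ (a i)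

lemma eval_update {A : M.Algebra} (ψ : B.Hom (A.restrict ω)) {n : ℕ} (a : Fin n → Expr M B)
    (i : Fin n) (b : Expr M B) :
    (fun j => eval ψ (Function.update a i b j)) =
      Function.update (fun j => eval ψ (a j)) i (eval ψ b) := by
  funext j
  exact Function.apply_update (fun _ => eval ψ) a i b j

lemma eval_rel {A : M.Algebra} (ψ : B.Hom (A.restrict ω)) {a b : Expr M B}
    (h : Rel ω B a b) : eval ψ a = eval ψ b := by
  induction h with
  | refl => rfl
  | symm _ h => exact h.symm
  | trans _ _ h h' => exact h.trans h'
  | add_congr _ _ h h' => simp only [eval, h, h']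
  | smul_congr c _ h => simp only [eval, h]
  | op_congr x _ h => simp only [eval, h]
  | add_assoc => simp only [eval, add_assoc]
  | add_comm => simp only [eval, add_comm]
  | zero_add => simp only [eval, zero_add]
  | neg_add => simp [eval]
  | one_smul => simp only [eval, one_smul]
  | mul_smul => simp only [eval, mul_smul]
  | smul_add => simp only [eval, smul_add]
  | add_smul => simp only [eval, add_smul]
  | op_add_left => simp only [eval, map_add, _root_.add_apply]
  | op_smul_left => simp only [eval, map_smul, _root_.smul_apply]
  | op_add => simp only [eval, eval_update, MultilinearMap.map_update_add]
  | op_smul => simp only [eval, eval_update, MultilinearMap.map_update_smul]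
  | op_one => simp only [eval, A.act_one]
  | op_map => simp only [eval, A.act_map]
  | op_comp => simp only [eval, A.act_comp]
  | of_add b c => exact map_add ψ.toLin b c
  | of_smul r b => exact map_smul ψ.toLin r b
  | of_act x b => exact ψ.map_act x b

/-- The homomorphism `U_ω(B) → A` induced by a homomorphism `B → A^(ω)`. -/
def lift {A : M.Algebra} (ψ : B.Hom (A.restrict ω)) : (UEnv ω B).Hom A where
  toLin :=
    { toFun := Quotient.lift (s := setoid ω B) (eval ψ) fun _ _ h => eval_rel ψ h
      map_add' := by
        intro a b
        obtain ⟨a, rfl⟩ := mk_surjective a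
        obtain ⟨b, rfl⟩ := mk_surjective b
        rfl
      map_smul' := by
        intro c a
        obtain ⟨a, rfl⟩ := mk_surjective a
        rfl }
  map_act x a := by
    obtain ⟨a, rfl⟩ := exists_rep a
    exact congrArg (Quotient.lift (s := setoid ω B) (eval ψ) fun _ _ h => eval_rel ψ h)
      (opMultilinear_mk x a)

/-- The universal property of `U_ω(B)`: for every `M`-algebra `A` and every homomorphism
`ψ : B → A^(ω)` there is a unique homomorphism `ξ : U_ω(B) → A` with `ξ ∘ ι = ψ`. -/
theorem existsUnique_lift {A : M.Algebra} (ψ : B.Hom (A.restrict ω)) :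
    ∃! ξ : (UEnv ω B).Hom A, ∀ b, ξ.toLin ((ι ω B).toLin b) = ψ.toLin b := by
  refine ⟨lift ψ, fun b => rfl, ?_⟩
  intro ξ hξ
  have h : ∀ a : Expr M B, ξ.toLin (mk ω a) = eval ψ a := by
    intro a
    induction a with
    | of b => exact hξ b
    | zero => exact map_zero ξ.toLin
    | add a b ha hb => exact (map_add ξ.toLin _ _).trans (congrArg₂ _ ha hb)
    | smul c a ha => exact (map_smul ξ.toLin _ _).trans (congrArg _ ha)
    | op x a ha =>
      rw [← opMultilinear_mk]
      exact (ξ.map_act x _).trans (congrArg _ (funext ha))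
  have h' : ξ.toLin = (lift ψ).toLin := by
    ext q
    obtain ⟨a, rfl⟩ := mk_surjective q
    exact h a
  cases ξ
  cases h'
  rfl

end UEnv

namespace NESub

/-- The full set `{1, …, n}`, `n ≥ 1`. -/
def full {n : ℕ} (hn : 0 < n) : NESub n := ⟨Finset.univ, ⟨⟨0, hn⟩, Finset.mem_univ _⟩⟩

lemma ext_iff' {n : ℕ} {H K : NESub n} : H = K ↔ ∀ i, i ∈ H.1 ↔ i ∈ K.1 := by
  rw [Subtype.ext_iff, Finset.ext_iff]

lemma map_map_symm {m n : ℕ} (e : Fin m ≃ Fin n) (H : NESub n) : map e (map e.symm H) = H := by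
  rw [ext_iff']
  intro i
  obtain ⟨i, rfl⟩ := e.surjective i
  rw [mem_map]
  have := mem_map e.symm H (e i)
  rwa [e.symm_apply_apply] at this

lemma ext_sigma {n : ℕ} {m : Fin n → ℕ} {H K : NESub (∑ i, m i)}
    (h : ∀ i (j : Fin (m i)), finSigmaFinEquiv ⟨i, j⟩ ∈ H.1 ↔ finSigmaFinEquiv ⟨i, j⟩ ∈ K.1) :
    H = K := by
  rw [ext_iff']
  intro p
  obtain ⟨⟨i, j⟩, rfl⟩ := finSigmaFinEquiv.surjective p
  exact h i j

lemma comp_congr {n : ℕ} (m : Fin n → ℕ) (K : NESub n) {H H' : ∀ i, NESub (m i)}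
    (h : ∀ i ∈ K.1, H i = H' i) : comp m K H = comp m K H' := by
  refine ext_sigma fun i j => ?_
  rw [mem_comp, mem_comp]
  constructor
  · rintro ⟨hi, hj⟩
    exact ⟨hi, h i hi ▸ hj⟩
  · rintro ⟨hi, hj⟩
    exact ⟨hi, (h i hi).symm ▸ hj⟩

lemma comp_full {n : ℕ} (m : Fin n → ℕ) (hn : 0 < n) (hm : ∀ i, 0 < m i)
    (hs : 0 < ∑ i, m i) :
    comp m (full hn) (fun i => full (hm i)) = full hs := by
  refine ext_sigma fun i j => ?_
  rw [mem_comp]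
  simp [full]

lemma exists_comp {n : ℕ} (m : Fin n → ℕ) (hm : ∀ i, 0 < m i) (H : NESub (∑ i, m i)) :
    ∃ (K : NESub n) (H' : ∀ i, NESub (m i)),
      comp m K H' = H ∧ ∀ i ∉ K.1, H' i = full (hm i) := by
  classical
  let B : ∀ i, Finset (Fin (m i)) := fun i =>
    Finset.univ.filter fun j => finSigmaFinEquiv ⟨i, j⟩ ∈ H.1
  have hB : ∀ i j, j ∈ B i ↔ finSigmaFinEquiv ⟨i, j⟩ ∈ H.1 := fun i j => by simp [B]
  refine ⟨⟨Finset.univ.filter fun i => (B i).Nonempty, ?_⟩,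
    fun i => if h : (B i).Nonempty then ⟨B i, h⟩ else full (hm i), ?_, ?_⟩
  · obtain ⟨p, hp⟩ := H.2
    obtain ⟨⟨i, j⟩, rfl⟩ := finSigmaFinEquiv.surjective p
    exact ⟨i, by simpa using ⟨j, (hB i j).2 hp⟩⟩
  · refine ext_sigma fun i j => ?_
    rw [mem_comp, ← hB]
    by_cases h : (B i).Nonempty
    · simp [h]
    · have : j ∉ B i := fun hj => h ⟨j, hj⟩
      simp [h, this]
  · intro i hi
    have : ¬ (B i).Nonempty := by simpa using hi
    simp [this]

lemma comp_inj {n : ℕ} (m : Fin n → ℕ) {K K' : NESub n} {H H' : ∀ i, NESub (m i)}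
    (h : comp m K H = comp m K' H') : K = K' ∧ ∀ i ∈ K.1, H i = H' i := by
  have h' : ∀ i (j : Fin (m i)), (i ∈ K.1 ∧ j ∈ (H i).1) ↔ (i ∈ K'.1 ∧ j ∈ (H' i).1) := by
    intro i j
    rw [← mem_comp, ← mem_comp, h]
  have hK : K = K' := by
    rw [ext_iff']
    intro i
    constructor
    · intro hi
      obtain ⟨j, hj⟩ := (H i).2
      exact ((h' i j).1 ⟨hi, hj⟩).1
    · intro hi
      obtain ⟨j, hj⟩ := (H' i).2
      exact ((h' i j).2 ⟨hi, hj⟩).1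
  subst hK
  refine ⟨rfl, fun i hi => ?_⟩
  rw [ext_iff']
  intro j
  have := h' i j
  simpa [hi] using this

end NESub

lemma multilinear_congr_mod {k : Type*} [Field k] {n : ℕ} {X Y : Type*} [AddCommGroup X]
    [Module k X] [AddCommGroup Y] [Module k Y] (f : MultilinearMap k (fun _ : Fin n => X) Y)
    (D : Fin n → Submodule k X) (S : Submodule k Y)
    (hf : ∀ a i, ∀ d ∈ D i, f (Function.update a i d) ∈ S) (a a' : Fin n → X)
    (h : ∀ i, a i - a' i ∈ D i) : f a - f a' ∈ S := by
  classical
  suffices key : ∀ (s : Finset (Fin n)) (a : Fin n → X), (∀ i, a i - a' i ∈ D i) →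
      (∀ i ∉ s, a i = a' i) → f a - f a' ∈ S from key Finset.univ a h (by simp)
  intro s
  induction s using Finset.induction_on with
  | empty =>
    intro a _ ha
    rw [show a = a' from funext fun i => ha i (by simp), sub_self]
    exact S.zero_mem
  | insert i s hi ih =>
    intro a ha ha'
    have h1 : f a - f (Function.update a i (a' i)) ∈ S := by
      have : f a - f (Function.update a i (a' i)) = f (Function.update a i (a i - a' i)) := by
        rw [MultilinearMap.map_update_sub, Function.update_eq_self]
      rw [this]
      exact hf a i _ (ha i)
    have h2 : f (Function.update a i (a' i)) - f a' ∈ S := by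
      apply ih
      · intro j
        by_cases hj : j = i
        · subst hj; simp
        · rw [Function.update_of_ne hj]; exact ha j
      · intro j hj
        by_cases hji : j = i
        · subst hji; simp
        · rw [Function.update_of_ne hji]
          exact ha' j (by simp [hji, hj])
    simpa using S.add_mem h1 h2

/-- The operad `tri-N = ComTrias ⊗ N` of tri-algebras over `N`. -/
abbrev Tri {k : Type u} [Field k] (N : Operad.{u, v} k) : Operad.{u, max u v} k :=
  (ComTrias k).hadamard N

namespace Tri

variable {k : Type u} [Field k] {N : Operad.{u, v} k} (T : Operad.Algebra.{u, max u v, w} (Tri N))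

/-- The operation `x^H = e_H ⊗ x` on a tri-algebra. -/
def act {n : ℕ} (H : NESub n) (x : N.Op n) :
    MultilinearMap k (fun _ : Fin n => T.carrier) T.carrier :=
  T.act (ComTrias.corolla k H ⊗ₜ[k] x)

variable {T}

lemma act_add {n : ℕ} (H : NESub n) (x y : N.Op n) : act T H (x + y) = act T H x + act T H y := by
  rw [act, TensorProduct.tmul_add]
  exact map_add T.act _ _

lemma act_smul {n : ℕ} (H : NESub n) (c : k) (x : N.Op n) : act T H (c • x) = c • act T H x := by
  rw [act, TensorProduct.tmul_smul]
  exact map_smul T.act _ _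

lemma act_zero {n : ℕ} (H : NESub n) : act T H (0 : N.Op n) = 0 := by
  rw [act, TensorProduct.tmul_zero]
  exact map_zero T.act

lemma act_one (H : NESub 1) (a : Fin 1 → T.carrier) : act T H N.one a = a 0 := by
  have hH : H = ⟨{0}, by simp⟩ := by
    rw [NESub.ext_iff']
    intro i
    obtain ⟨j, hj⟩ := H.2
    rw [Subsingleton.elim j 0] at hj
    rw [Subsingleton.elim i 0]
    simpa using hj
  subst hH
  exact T.act_one a

lemma act_map {m n : ℕ} (e : Fin m ≃ Fin n) (H : NESub m) (x : N.Op m) (a : Fin n → T.carrier) :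
    act T (NESub.map e H) (N.map e x) a = act T H x fun i => a (e i) := by
  have h : ComTrias.corolla k (NESub.map e H) ⊗ₜ[k] N.map e x =
      TensorProduct.map (Finsupp.lmapDomain k k (NESub.map e)) (N.map e)
        (Finsupp.single H 1 ⊗ₜ[k] x) := by
    rw [TensorProduct.map_tmul, Finsupp.lmapDomain_apply, Finsupp.mapDomain_single]
    rfl
  exact (congrArg (fun z => T.act z a) h).trans
    (T.act_map e (ComTrias.corolla k H ⊗ₜ[k] x) a)

lemma act_comp {n : ℕ} (m : Fin n → ℕ) (K : NESub n) (H : ∀ i, NESub (m i)) (x : N.Op n)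
    (y : ∀ i, N.Op (m i)) (a : Fin (∑ i, m i) → T.carrier) :
    act T (NESub.comp m K H) (N.comp m x y) a =
      act T K x fun i => act T (H i) (y i) fun j => a (finSigmaFinEquiv ⟨i, j⟩) := by
  have h : ComTrias.corolla k (NESub.comp m K H) ⊗ₜ[k] N.comp m x y =
      boxLin (ComTrias.compLin k m) (N.comp m) (Finsupp.single K 1 ⊗ₜ[k] x)
        fun i => Finsupp.single (H i) 1 ⊗ₜ[k] y i := by
    rw [boxLin_tmul, ComTrias.compLin_single, Finset.prod_const_one, mul_one]
    rfl
  exact (congrArg (fun z => T.act z a) h).trans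
    (T.act_comp m (ComTrias.corolla k K ⊗ₜ[k] x)
      (fun i => ComTrias.corolla k (H i) ⊗ₜ[k] y i) a)

lemma act_act {n : ℕ} (m : Fin n → ℕ) (K : NESub n) (H : ∀ i, NESub (m i)) (x : N.Op n)
    (y : ∀ i, N.Op (m i)) (b : ∀ i, Fin (m i) → T.carrier) :
    (act T K x fun i => act T (H i) (y i) (b i)) =
      act T (NESub.comp m K H) (N.comp m x y)
        (fun p => (fun q : (i : Fin n) × Fin (m i) => b q.1 q.2) (finSigmaFinEquiv.symm p)) := by
  rw [act_comp]
  congr 1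
  funext i
  congr 1
  funext j
  exact (congrArg (fun q : (i : Fin n) × Fin (m i) => b q.1 q.2)
    (finSigmaFinEquiv.symm_apply_apply ⟨i, j⟩)).symm

lemma act_act_congr {n : ℕ} (m : Fin n → ℕ) (K : NESub n) {H H' : ∀ i, NESub (m i)}
    (h : ∀ i ∈ K.1, H i = H' i) (x : N.Op n)
    (y : ∀ i, N.Op (m i)) (b : ∀ i, Fin (m i) → T.carrier) :
    (act T K x fun i => act T (H i) (y i) (b i)) =
      act T K x fun i => act T (H' i) (y i) (b i) := by
  rw [act_act, act_act, NESub.comp_congr m K h]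

/-- Replacing the decoration of an operation substituted into a non-emphasized variable. -/
lemma act_update_eq {n l : ℕ} (K : NESub n) (x : N.Op n) (a : Fin n → T.carrier) (i : Fin n)
    (hi : i ∉ K.1) (f : N.Op l) (S Q : NESub l) (b : Fin l → T.carrier) :
    act T K x (Function.update a i (act T S f b)) =
      act T K x (Function.update a i (act T Q f b)) := by
  classical
  let one : NESub 1 := ⟨{0}, by simp⟩
  let nd : Fin n → Σ m : ℕ, (N.Op m × (Fin m → T.carrier)) × (NESub m × NESub m) :=
    Function.update (fun j => ⟨1, (N.one, fun _ => a j), (one, one)⟩) i ⟨l, (f, b), (S, Q)⟩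
  have hself : nd i = ⟨l, (f, b), (S, Q)⟩ := Function.update_self _ _ _
  have hne : ∀ j, j ≠ i → nd j = ⟨1, (N.one, fun _ => a j), (one, one)⟩ := fun j hj =>
    Function.update_of_ne hj _ _
  have hS : Function.update a i (act T S f b) =
      fun j => act T (nd j).2.2.1 (nd j).2.1.1 (nd j).2.1.2 := by
    funext j
    by_cases hj : j = i
    · subst hj
      rw [hself, Function.update_self]
    · rw [hne j hj, Function.update_of_ne hj, act_one]
  have hQ : Function.update a i (act T Q f b) =
      fun j => act T (nd j).2.2.2 (nd j).2.1.1 (nd j).2.1.2 := by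
    funext j
    by_cases hj : j = i
    · subst hj
      rw [hself, Function.update_self]
    · rw [hne j hj, Function.update_of_ne hj, act_one]
  rw [hS, hQ]
  refine act_act_congr (fun j => (nd j).1) K ?_ x (fun j => (nd j).2.1.1) (fun j => (nd j).2.1.2)
  intro j hj
  have : j ≠ i := fun h => hi (h ▸ hj)
  rw [hne j this]

variable (G : N.Generators) (T)

/-- The subspace `T₀` of a tri-algebra `T`: the span of all differences
`f^H(a₁, …, aₙ) - f^K(a₁, …, aₙ)`, where `f` is an operation of the language of `N`. -/
def zeroPart : Submodule k T.carrier :=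
  Submodule.span k {d | ∃ (f : G.Sym) (H K : NESub (G.arity f)) (a : Fin (G.arity f) → T.carrier),
    d = act T H (G.op f) a - act T K (G.op f) a}

variable {T G}

lemma act_update_zeroPart {n : ℕ} (K : NESub n) (x : N.Op n) (a : Fin n → T.carrier) (i : Fin n)
    (hi : i ∉ K.1) {d : T.carrier} (hd : d ∈ zeroPart T G) :
    act T K x (Function.update a i d) = 0 := by
  induction hd using Submodule.span_induction with
  | mem d hd =>
    obtain ⟨f, S, Q, b, rfl⟩ := hd
    rw [MultilinearMap.map_update_sub, act_update_eq K x a i hi _ S Q, sub_self]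
  | zero => exact MultilinearMap.map_update_zero _ _ _
  | add c d _ _ hc hd => rw [MultilinearMap.map_update_add, hc, hd, add_zero]
  | smul r c _ hc => rw [MultilinearMap.map_update_smul, hc, smul_zero]

lemma act_congr {n : ℕ} (K : NESub n) (x : N.Op n) (a a' : Fin n → T.carrier)
    (h1 : ∀ i ∈ K.1, a i = a' i) (h2 : ∀ i ∉ K.1, a i - a' i ∈ zeroPart T G) :
    act T K x a = act T K x a' := by
  have := multilinear_congr_mod (act T K x) (fun i => if i ∈ K.1 then ⊥ else zeroPart T G) ⊥
    (by
      intro b i d hd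
      by_cases hi : i ∈ K.1
      · have hd : d = 0 := by simpa [hi] using hd
        rw [hd, MultilinearMap.map_update_zero]
        exact Submodule.zero_mem _
      · have hd : d ∈ zeroPart T G := by simpa [hi] using hd
        rw [act_update_zeroPart K x b i hi hd]
        exact Submodule.zero_mem _) a a'
    (by
      intro i
      by_cases hi : i ∈ K.1
      · simp [hi, h1 i hi]
      · simpa [hi] using h2 i hi)
  exact sub_eq_zero.1 (by simpa using this)

/-- `T₀` is an ideal containing all differences `x^H(a) - x^K(a)`. -/
lemma zeroPart_ideal (hG : ∀ f, 2 ≤ G.arity f) {n : ℕ} (x : N.Op n) :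
    (∀ (H K : NESub n) (a : Fin n → T.carrier), act T H x a - act T K x a ∈ zeroPart T G) ∧
    (∀ (H : NESub n) (a : Fin n → T.carrier) (i : Fin n), a i ∈ zeroPart T G →
      act T H x a ∈ zeroPart T G) := by
  let S : ∀ n, Submodule k (N.Op n) := fun n =>
    { carrier := {x | (∀ (H K : NESub n) (a : Fin n → T.carrier),
          act T H x a - act T K x a ∈ zeroPart T G) ∧
        (∀ (H : NESub n) (a : Fin n → T.carrier) (i : Fin n), a i ∈ zeroPart T G →
          act T H x a ∈ zeroPart T G)}
      zero_mem' := by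
        refine ⟨fun H K a => ?_, fun H a i _ => ?_⟩ <;>
          simp only [act_zero, _root_.zero_apply, sub_self, Submodule.zero_mem]
      add_mem' := by
        rintro x y ⟨hx, hx'⟩ ⟨hy, hy'⟩
        refine ⟨fun H K a => ?_, fun H a i hi => ?_⟩
        · simp only [act_add, _root_.add_apply, add_sub_add_comm]
          exact Submodule.add_mem _ (hx H K a) (hy H K a)
        · simp only [act_add, _root_.add_apply]
          exact Submodule.add_mem _ (hx' H a i hi) (hy' H a i hi)
      smul_mem' := by
        rintro c x ⟨hx, hx'⟩
        refine ⟨fun H K a => ?_, fun H a i hi => ?_⟩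
        · simp only [act_smul, _root_.smul_apply, ← smul_sub]
          exact Submodule.smul_mem _ _ (hx H K a)
        · simp only [act_smul, _root_.smul_apply]
          exact Submodule.smul_mem _ _ (hx' H a i hi) }
  have hS : ∀ n, S n = ⊤ := by
    refine G.generates S ?_ ?_ ?_ ?_
    · refine ⟨fun H K a => ?_, fun H a i hi => ?_⟩
      · simp only [act_one, sub_self, Submodule.zero_mem]
      · rw [act_one, Subsingleton.elim 0 i]
        exact hi
    · rintro m n e x ⟨hx, hx'⟩
      have hmap : ∀ H : NESub n, ∃ H', H = NESub.map e H' := by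
        intro H
        exact ⟨NESub.map e.symm H, (NESub.map_map_symm e H).symm⟩
      refine ⟨fun H K a => ?_, fun H a i hi => ?_⟩
      · obtain ⟨H, rfl⟩ := hmap H
        obtain ⟨K, rfl⟩ := hmap K
        rw [act_map, act_map]
        exact hx H K _
      · obtain ⟨H, rfl⟩ := hmap H
        rw [act_map]
        exact hx' H _ (e.symm i) (by simpa using hi)
    · rintro n m x y ⟨hx, hx'⟩ hy
      by_cases hm : ∀ i, 0 < m i
      · refine ⟨fun H K a => ?_, fun H a p hp => ?_⟩
        · obtain ⟨H, H', rfl, -⟩ := NESub.exists_comp m hm H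
          obtain ⟨K, K', rfl, -⟩ := NESub.exists_comp m hm K
          rw [act_comp, act_comp, ← sub_add_sub_cancel]
          refine Submodule.add_mem _ (hx H K _) ?_
          refine multilinear_congr_mod _ (fun _ => zeroPart T G) _ ?_ _ _ ?_
          · intro b i d hd
            exact hx' K _ i (by simpa using hd)
          · intro i
            exact (hy i).1 _ _ _
        · obtain ⟨H, H', rfl, -⟩ := NESub.exists_comp m hm H
          obtain ⟨⟨i, j⟩, rfl⟩ := finSigmaFinEquiv.surjective p
          rw [act_comp]
          exact hx' H _ i ((hy i).2 _ _ j hp)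
      · push Not at hm
        obtain ⟨i, hi⟩ := hm
        have hz : N.comp m x y = 0 := by
          refine MultilinearMap.map_coord_zero _ i ?_
          have hs : ∀ l, l ≤ 0 → Subsingleton (N.Op l) := by
            intro l hl
            obtain rfl := Nat.le_zero.1 hl
            exact N.subsingleton_zero
          have := hs _ hi
          exact Subsingleton.elim _ _
        rw [hz]
        exact Submodule.zero_mem _
    · intro f
      have h1 : ∀ (H K : NESub (G.arity f)) (a : Fin (G.arity f) → T.carrier),
          act T H (G.op f) a - act T K (G.op f) a ∈ zeroPart T G :=
        fun H K a => Submodule.subset_span ⟨f, H, K, a, rfl⟩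
      refine ⟨h1, fun H a i hi => ?_⟩
      have : Nontrivial (Fin (G.arity f)) := Fin.nontrivial_iff_two_le.2 (hG f)
      obtain ⟨j, hj⟩ := exists_ne i
      have h2 := h1 H ⟨{j}, by simp⟩ a
      have h3 : act T ⟨{j}, by simp⟩ (G.op f) a = 0 := by
        have := act_update_zeroPart (G := G) (T := T) ⟨{j}, by simp⟩ (G.op f) a i
          (by simpa using hj.symm) hi
        rwa [Function.update_eq_self] at this
      rwa [h3, sub_zero] at h2
  have hx : x ∈ S n := by rw [hS n]; trivial
  exact hx

lemma act_congr_mod (hG : ∀ f, 2 ≤ G.arity f) {n : ℕ} (x : N.Op n) (H K : NESub n)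
    (a a' : Fin n → T.carrier) (h : ∀ i, a i - a' i ∈ zeroPart T G) :
    act T H x a - act T K x a' ∈ zeroPart T G := by
  rw [← sub_add_sub_cancel (act T H x a) (act T K x a)]
  refine Submodule.add_mem _ ((zeroPart_ideal hG x).1 H K a) ?_
  refine multilinear_congr_mod _ (fun _ => zeroPart T G) _ ?_ _ _ h
  intro b i d hd
  exact (zeroPart_ideal hG x).2 K _ i (by simpa using hd)

/-- The arguments `c₁^H, …, cₙ^H`: `cᵢ^H = bᵢ` for `i ∈ H` and `cᵢ^H = aᵢ` for `i ∉ H`. -/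
def mix {n : ℕ} {X : Type*} (H : NESub n) (a b : Fin n → X) (i : Fin n) : X :=
  if i ∈ H.1 then b i else a i

lemma mix_update {n : ℕ} {X : Type*} (H : NESub n) (a b : Fin n → X) (i : Fin n) (α β : X) :
    mix H (Function.update a i α) (Function.update b i β) =
      Function.update (mix H a b) i (if i ∈ H.1 then β else α) := by
  funext j
  by_cases hj : j = i
  · subst hj; simp [mix]
  · simp [mix, hj]

variable (T G)

/-- A representative in `T` of an element of `T / T₀`. -/
def rep (q : T.carrier ⧸ zeroPart T G) : T.carrier := q.out

/-- The operation `x` on `T̃ = T / T₀ ⊕ T`: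
`x(ā₁ + b₁, …, āₙ + bₙ) = \overline{x^K(a₁, …, aₙ)} + ∑_H x^H(c₁^H, …, cₙ^H)`, where the set `K`
and the representatives `aᵢ` are arbitrary (see `tildeFun_eq`). -/
def tildeFun {n : ℕ} (x : N.Op n) (p : Fin n → (T.carrier ⧸ zeroPart T G) × T.carrier) :
    (T.carrier ⧸ zeroPart T G) × T.carrier :=
  (if hn : 0 < n then
      (zeroPart T G).mkQ (act T (NESub.full hn) x fun i => rep T G (p i).1) else 0,
    ∑ H : NESub n, act T H x (mix H (fun i => rep T G (p i).1) fun i => (p i).2))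

variable {T G}

lemma mkQ_rep (q : T.carrier ⧸ zeroPart T G) : (zeroPart T G).mkQ (rep T G q) = q :=
  Quotient.out_eq' q

lemma mkQ_eq {a b : T.carrier} : (zeroPart T G).mkQ a = (zeroPart T G).mkQ b ↔
    a - b ∈ zeroPart T G := by
  rw [Submodule.mkQ_apply, Submodule.mkQ_apply, Submodule.Quotient.eq]

/-- `tildeFun` may be computed with any representatives and any set `K`. -/
lemma tildeFun_eq (hG : ∀ f, 2 ≤ G.arity f) {n : ℕ} (K : NESub n) (x : N.Op n)
    (a b : Fin n → T.carrier) :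
    tildeFun T G x (fun i => ((zeroPart T G).mkQ (a i), b i)) =
      ((zeroPart T G).mkQ (act T K x a), ∑ H : NESub n, act T H x (mix H a b)) := by
  have hrep : ∀ i, rep T G ((zeroPart T G).mkQ (a i)) - a i ∈ zeroPart T G := fun i =>
    mkQ_eq.1 (mkQ_rep _)
  have hn : 0 < n := by
    obtain ⟨i, -⟩ := K.2
    exact i.pos
  rw [tildeFun, dif_pos hn]
  congr 1
  · rw [mkQ_eq]
    exact act_congr_mod hG x _ K _ a hrep
  · refine Finset.sum_congr rfl fun H _ => ?_
    refine act_congr (G := G) H x _ _ (fun i hi => ?_) fun i hi => ?_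
    · simp [mix, hi]
    · simpa [mix, hi] using hrep i

lemma exists_pair {n : ℕ} (p : Fin n → (T.carrier ⧸ zeroPart T G) × T.carrier) :
    ∃ a b : Fin n → T.carrier, p = fun i => ((zeroPart T G).mkQ (a i), b i) :=
  ⟨fun i => rep T G (p i).1, fun i => (p i).2, funext fun i => by rw [mkQ_rep]⟩

lemma pair_update {n : ℕ} (a b : Fin n → T.carrier) (i : Fin n) (α β : T.carrier) :
    Function.update (fun i => ((zeroPart T G).mkQ (a i), b i)) i ((zeroPart T G).mkQ α, β) =
      fun j => ((zeroPart T G).mkQ (Function.update a i α j), Function.update b i β j) := by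
  funext j
  by_cases hj : j = i
  · subst hj; simp
  · simp [hj]

/-- `tildeFun x` as a multilinear map. -/
def tildeMultilinear (hG : ∀ f, 2 ≤ G.arity f) {n : ℕ} (x : N.Op n) :
    MultilinearMap k (fun _ : Fin n => (T.carrier ⧸ zeroPart T G) × T.carrier)
      ((T.carrier ⧸ zeroPart T G) × T.carrier) :=
  MultilinearMap.mk' (tildeFun T G x)
    (by
      intro p i q q'
      obtain ⟨a, b, rfl⟩ := exists_pair p
      obtain ⟨q, β⟩ := q
      obtain ⟨q', β'⟩ := q'
      obtain ⟨α, rfl⟩ := (zeroPart T G).mkQ_surjective q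
      obtain ⟨α', rfl⟩ := (zeroPart T G).mkQ_surjective q'
      rw [Prod.mk_add_mk, ← map_add, pair_update, pair_update, pair_update,
        tildeFun_eq hG ⟨{i}, by simp⟩, tildeFun_eq hG ⟨{i}, by simp⟩,
        tildeFun_eq hG ⟨{i}, by simp⟩, Prod.mk_add_mk, ← map_add, MultilinearMap.map_update_add,
        ← Finset.sum_add_distrib]
      congr 1
      refine Finset.sum_congr rfl fun H _ => ?_
      simp only [mix_update]
      split_ifs <;> rw [MultilinearMap.map_update_add])
    (by
      intro p i r q
      obtain ⟨a, b, rfl⟩ := exists_pair p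
      obtain ⟨q, β⟩ := q
      obtain ⟨α, rfl⟩ := (zeroPart T G).mkQ_surjective q
      rw [Prod.smul_mk, ← map_smul, pair_update, pair_update,
        tildeFun_eq hG ⟨{i}, by simp⟩, tildeFun_eq hG ⟨{i}, by simp⟩,
        Prod.smul_mk, ← map_smul, MultilinearMap.map_update_smul, Finset.smul_sum]
      congr 1
      refine Finset.sum_congr rfl fun H _ => ?_
      simp only [mix_update]
      split_ifs <;> rw [MultilinearMap.map_update_smul])

lemma tildeFun_comp (hG : ∀ f, 2 ≤ G.arity f) {n : ℕ} (m : Fin n → ℕ) (x : N.Op n)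
    (y : ∀ i, N.Op (m i)) (p : Fin (∑ i, m i) → (T.carrier ⧸ zeroPart T G) × T.carrier)
    (hn : 0 < n) (hm : ∀ i, 0 < m i) :
    tildeFun T G (N.comp m x y) p =
      tildeFun T G x fun i => tildeFun T G (y i) fun j => p (finSigmaFinEquiv ⟨i, j⟩) := by
  classical
  obtain ⟨a, b, rfl⟩ := exists_pair p
  have hs : 0 < ∑ i, m i := lt_of_lt_of_le (hm ⟨0, hn⟩)
    (Finset.single_le_sum (f := m) (fun _ _ => Nat.zero_le _) (Finset.mem_univ _))
  rw [tildeFun_eq hG (NESub.full hs)]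
  have hy : ∀ i, (tildeFun T G (y i) fun j => ((zeroPart T G).mkQ (a (finSigmaFinEquiv ⟨i, j⟩)),
      b (finSigmaFinEquiv ⟨i, j⟩))) = _ := fun i => tildeFun_eq hG (NESub.full (hm i)) (y i) _ _
  simp only [hy]
  rw [tildeFun_eq hG (NESub.full hn)]
  congr 1
  · rw [← NESub.comp_full m hn hm hs, act_comp]
  · -- expand the right-hand side by multilinearity
    let A : NESub n → ∀ i, Finset (NESub (m i)) := fun K i =>
      if i ∈ K.1 then Finset.univ else {NESub.full (hm i)}
    have hexp : ∀ K : NESub n, act T K x (mix K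
        (fun i => act T (NESub.full (hm i)) (y i) fun j => a (finSigmaFinEquiv ⟨i, j⟩))
        (fun i => ∑ H : NESub (m i), act T H (y i)
          (mix H (fun j => a (finSigmaFinEquiv ⟨i, j⟩)) fun j => b (finSigmaFinEquiv ⟨i, j⟩)))) =
        ∑ r ∈ Fintype.piFinset (A K), act T (NESub.comp m K r) (N.comp m x y)
          (mix (NESub.comp m K r) a b) := by
      intro K
      have h1 : (mix K
          (fun i => act T (NESub.full (hm i)) (y i) fun j => a (finSigmaFinEquiv ⟨i, j⟩))
          (fun i => ∑ H : NESub (m i), act T H (y i)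
            (mix H (fun j => a (finSigmaFinEquiv ⟨i, j⟩))
              fun j => b (finSigmaFinEquiv ⟨i, j⟩)))) =
          fun i => ∑ H ∈ A K i, act T H (y i) (if i ∈ K.1 then
            (mix H (fun j => a (finSigmaFinEquiv ⟨i, j⟩)) fun j => b (finSigmaFinEquiv ⟨i, j⟩))
            else fun j => a (finSigmaFinEquiv ⟨i, j⟩)) := by
        funext i
        by_cases hi : i ∈ K.1
        · simp [mix, A, hi]
        · simp [mix, A, hi]
      rw [h1, MultilinearMap.map_sum_finset]
      refine Finset.sum_congr rfl fun r _ => ?_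
      rw [act_comp]
      congr 1
      funext i
      congr 1
      by_cases hi : i ∈ K.1
      · rw [if_pos hi]
        funext j
        simp only [mix, NESub.mem_comp, hi, true_and]
      · rw [if_neg hi]
        funext j
        simp only [mix, NESub.mem_comp, hi, false_and, if_false]
    rw [Finset.sum_congr rfl fun K _ => hexp K, Finset.sum_sigma']
    symm
    refine Finset.sum_bij (fun q _ => NESub.comp m q.1 q.2) (fun _ _ => Finset.mem_univ _)
      ?_ ?_ (fun _ _ => rfl)
    · rintro ⟨K, r⟩ hr ⟨K', r'⟩ hr' h
      obtain ⟨rfl, h'⟩ := NESub.comp_inj m h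
      simp only [Finset.mem_sigma, Finset.mem_univ, true_and, Fintype.mem_piFinset] at hr hr'
      congr 1
      funext i
      by_cases hi : i ∈ K.1
      · exact h' i hi
      · have h1 := hr i
        have h2 := hr' i
        simp only [A, hi, if_false, Finset.mem_singleton] at h1 h2
        rw [h1, h2]
    · intro H _
      obtain ⟨K, r, hK, hr⟩ := NESub.exists_comp m hm H
      refine ⟨⟨K, r⟩, ?_, hK⟩
      simp only [Finset.mem_sigma, Finset.mem_univ, true_and, Fintype.mem_piFinset]
      intro i
      by_cases hi : i ∈ K.1
      · simp [A, hi]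
      · simp [A, hi, hr i hi]

lemma tildeFun_zero {n : ℕ} (p : Fin n → (T.carrier ⧸ zeroPart T G) × T.carrier) :
    tildeFun T G (0 : N.Op n) p = 0 := by
  simp only [tildeFun, act_zero, _root_.zero_apply, map_zero, Finset.sum_const_zero]
  split_ifs <;> rfl

lemma op_eq_zero {n : ℕ} (hn : ¬ 0 < n) (x : N.Op n) : x = 0 := by
  obtain rfl : n = 0 := by omega
  have := N.subsingleton_zero
  exact Subsingleton.elim _ _

variable (G T)

/-- The `N`-algebra `T̃ = T̄ ⊕ T`, `T̄ = T / T₀`, of a `tri-N`-algebra `T`, where `N` is generated by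
operations `f` of arity at least two, with the operations
`f(ā₁ + b₁, …, āₙ + bₙ) = \overline{f^K(a₁, …, aₙ)} + ∑_H f^H(c₁^H, …, cₙ^H)`. The same formula
holds for all operations of `N`, so the whole action of `N` is given by it. -/
def tilde (hG : ∀ f, 2 ≤ G.arity f) : Operad.Algebra.{u, v, w} N where
  carrier := (T.carrier ⧸ zeroPart T G) × T.carrier
  act :=
    { toFun := tildeMultilinear hG
      map_add' := by
        intro x y
        ext1 p
        show tildeFun T G (x + y) p = tildeFun T G x p + tildeFun T G y p
        simp only [tildeFun, act_add, _root_.add_apply, Finset.sum_add_distrib, map_add,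
          Prod.mk_add_mk]
        congr 1
        split_ifs <;> simp
      map_smul' := by
        intro c x
        ext1 p
        show tildeFun T G (c • x) p = c • tildeFun T G x p
        simp only [tildeFun, act_smul, _root_.smul_apply, ← Finset.smul_sum, map_smul,
          Prod.smul_mk]
        congr 1
        split_ifs <;> simp }
  act_one p := by
    show tildeFun T G N.one p = p 0
    obtain ⟨a, b, rfl⟩ := exists_pair p
    rw [tildeFun_eq hG (NESub.full one_pos), act_one]
    have h : (Finset.univ : Finset (NESub 1)) = {NESub.full one_pos} := by
      ext H
      simp only [Finset.mem_univ, Finset.mem_singleton, true_iff]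
      rw [NESub.ext_iff']
      intro i
      obtain ⟨j, hj⟩ := H.2
      rw [Subsingleton.elim j i] at hj
      exact ⟨fun _ => Finset.mem_univ _, fun _ => hj⟩
    rw [h, Finset.sum_singleton, act_one]
    simp [mix, NESub.full]
  act_map {m n} e x p := by
    show tildeFun T G (N.map e x) p = tildeFun T G x fun i => p (e i)
    by_cases hm : 0 < m
    · obtain ⟨a, b, rfl⟩ := exists_pair p
      rw [tildeFun_eq hG (NESub.map e (NESub.full hm)), tildeFun_eq hG (NESub.full hm), act_map]
      congr 1
      have hbij : Function.Bijective (NESub.map e) := by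
        constructor
        · intro H K h
          rw [NESub.ext_iff']
          intro i
          rw [← NESub.mem_map e, h, NESub.mem_map]
        · intro H
          exact ⟨NESub.map e.symm H, NESub.map_map_symm e H⟩
      rw [← hbij.sum_comp]
      refine Finset.sum_congr rfl fun H _ => ?_
      rw [act_map]
      congr 1
      funext i
      simp only [mix, NESub.mem_map]
    · rw [op_eq_zero hm x, map_zero, tildeFun_zero, tildeFun_zero]
  act_comp {n} m x y p := by
    show tildeFun T G (N.comp m x y) p =
      tildeFun T G x fun i => tildeFun T G (y i) fun j => p (finSigmaFinEquiv ⟨i, j⟩)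
    by_cases hn : 0 < n
    · by_cases hm : ∀ i, 0 < m i
      · exact tildeFun_comp hG m x y p hn hm
      · push Not at hm
        obtain ⟨i, hi⟩ := hm
        have hyi : y i = 0 := op_eq_zero (by omega) _
        rw [MultilinearMap.map_coord_zero _ i hyi, tildeFun_zero]
        symm
        exact MultilinearMap.map_coord_zero (tildeMultilinear hG x) i
          (by rw [hyi, tildeFun_zero])
    · rw [op_eq_zero hn x, map_zero, _root_.zero_apply, tildeFun_zero, tildeFun_zero]

variable {T}

/-- The element `ā` of `T̄ ⊆ T̃`. -/
def bar (hG : ∀ f, 2 ≤ G.arity f) (a : T.carrier) : (tilde T G hG).carrier :=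
  ((zeroPart T G).mkQ a, 0)

/-- The element `a ∈ T` as an element of `T̃`. -/
def incl (hG : ∀ f, 2 ≤ G.arity f) (a : T.carrier) : (tilde T G hG).carrier :=
  ((0 : T.carrier ⧸ zeroPart T G), a)

end Tri

end

/-! ### Homomorphisms of algebras and generated subalgebras -/

namespace Operad.Algebra

variable {k : Type u} [Field k]

/-! The engine is the doubling map `δ_S : S → C₂ ⊗ S̃`, `a ↦ e₁ ⊗ ā + e₂ ⊗ a`, defined for every
tri-algebra `S` over an operad generated in arities at least two. It is an injective homomorphism of
tri-algebras. Injectivity is clear from the `e₂`-component. For the homomorphism property, expand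
`f^H` on elements `e₁ ⊗ pᵢ + e₂ ⊗ qᵢ`: the multiplication table of `C₂` keeps just two terms, `e₁ ⊗
f(p₁, …, pₙ)` and `e₂ ⊗ f(c₁, …, cₙ)`, where `cᵢ = qᵢ` for `i ∈ H` and `cᵢ = pᵢ` otherwise
(`act_pair`). In `S̃` these two values of `f` at barred and unbarred copies of the `aᵢ` are the bar
of `f^H(a₁, …, aₙ)` and `f^H(a₁, …, aₙ)` itself (`tilde_act_bar`, `tilde_act_mix`).

Write `U = U_{id⊗ω}(T)`. Composing `δ_T` with `id ⊗ ι : C₂ ⊗ T̃ → C₂ ⊗ U_ω(T̃)` gives a homomorphism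
`τ` of tri-`N`-algebras on `T`, which extends to a homomorphism `τ' : U → C₂ ⊗ U_ω(T̃)` of
tri-`M`-algebras. Since `U` is generated by the image of `T`, the range of `τ'` is the subalgebra
generated by the elements `τ(a)` (`UEnv.range_lift`). It remains to see that `τ'` is injective.

For this the tilde construction is applied a second time, to the tri-`M`-algebra `U`. The canonical
map `T → U` induces a homomorphism `T̃ → Ũ^(ω)` (`tildeMap`), and hence a homomorphism `ζ : U_ω(T̃)
→ Ũ` of `M`-algebras. The composite `(id ⊗ ζ) ∘ τ'` and the doubling map `δ_U : U → C₂ ⊗ Ũ` agree on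
the image of `T`, so they are equal by the uniqueness of extensions (`UEnv.hom_ext`). As `δ_U` is
injective, so is `τ'`. -/

lemma act_mem_adjoinSubmodule {P : Operad.{u, v} k} (B : P.Algebra) (s : Set B.carrier) {n : ℕ} (x : P.Op n) (a : Fin n → B.carrier)
    (ha : ∀ i, a i ∈ B.adjoinSubmodule s) : B.act x a ∈ B.adjoinSubmodule s :=
  Submodule.mem_sInf.2 fun S hS => hS.2 _ _ _ fun i => Submodule.mem_sInf.1 (ha i) S hS

namespace Hom

variable {P : Operad.{u, v} k} {A : P.Algebra} {B : P.Algebra}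

/-- The composition of homomorphisms. -/
def comp {C : P.Algebra} (φ : A.Hom B) (ψ : B.Hom C) : A.Hom C where
  toLin := ψ.toLin ∘ₗ φ.toLin
  map_act x a := by
    simp only [LinearMap.comp_apply, φ.map_act, ψ.map_act]

/-- A homomorphism of `M`-algebras is a homomorphism of `N`-algebras, along `ω : N → M`. -/
def restrict {N : Operad.{u, w} k} (ω : N.Hom P) (φ : A.Hom B) :
    (A.restrict ω).Hom (B.restrict ω) where
  toLin := φ.toLin
  map_act x a := φ.map_act (ω.toFun _ x) a

/-- The range of a homomorphism is closed under all operations, so it is one of the subspaces whose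
intersection is the generated subalgebra. -/
lemma adjoinSubmodule_range_le (φ : A.Hom B) (s : Set B.carrier)
    (hs : s ⊆ LinearMap.range φ.toLin) : B.adjoinSubmodule s ≤ LinearMap.range φ.toLin := by
  refine sInf_le ⟨hs, fun n x a ha => ?_⟩
  choose b hb using ha
  exact ⟨A.act x b, by rw [φ.map_act, funext hb]⟩

/-- An injective homomorphism identifies its source with a subalgebra generated by `s`, provided
its range is the underlying space of that subalgebra. -/
noncomputable def isoAdjoin (φ : A.Hom B) (hφ : Function.Injective φ.toLin) (s : Set B.carrier)
    (h : LinearMap.range φ.toLin = B.adjoinSubmodule s) : A.Iso (B.adjoin s) where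
  toLin := (LinearEquiv.ofInjective φ.toLin hφ).trans (LinearEquiv.ofEq _ _ h)
  map_act x a := Subtype.ext (φ.map_act x a)

end Hom

lemma tensor_act_tmul {P : Operad.{u, v} k} {Q : Operad.{u, w} k} (A : P.Algebra)
    (B : Q.Algebra) {n : ℕ} (x : P.Op n) (y : Q.Op n) (a : Fin n → A.carrier)
    (b : Fin n → B.carrier) :
    (A.tensor B).act (x ⊗ₜ[k] y) (fun i => (a i ⊗ₜ[k] b i : A.carrier ⊗[k] B.carrier)) =
      (A.act x a ⊗ₜ[k] B.act y b : A.carrier ⊗[k] B.carrier) :=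
  boxLin_tmul (V := fun _ => A.carrier) (W := fun _ => B.carrier) _ _ _ _ _ _

end Operad.Algebra

/-! ### The multiplication table of `C₂` -/

namespace ComTrias

variable {k : Type u} [Field k]

lemma C2_act_corolla {n : ℕ} (H : NESub n) (v : Fin n → (C2 k).carrier) :
    (C2 k).act (corolla k H) v =
      (∏ i, (v i : k × k).1) • e₁ k +
        (∏ i, if i ∈ H.1 then (v i : k × k).2 else (v i : k × k).1) • e₂ k := by
  refine (actC2_single H 1 v).trans ((one_smul _ _).trans ((corollaAct_apply H v).trans ?_))
  show ((_, _) : k × k) = (_ : k) • ((1, 0) : k × k) + (_ : k) • ((0, 1) : k × k)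
  simp

/-- The action of `e_H` on a family of basis vectors of `C₂`. -/
lemma C2_act_corolla_piecewise {n : ℕ} (H : NESub n) (s : Finset (Fin n)) :
    (C2 k).act (corolla k H) (s.piecewise (fun _ => e₁ k) fun _ => e₂ k) =
      (if s = Finset.univ then (1 : k) else 0) • e₁ k +
        (if s = H.1ᶜ then (1 : k) else 0) • e₂ k := by
  have h1 : ∀ i, ((s.piecewise (fun _ => e₁ k) (fun _ => e₂ k) i : (C2 k).carrier) : k × k).1 =
      if i ∈ s then (1 : k) else 0 := fun i => by
    by_cases hi : i ∈ s <;> simp only [Finset.piecewise, hi, if_true, if_false] <;> rfl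
  have h2 : ∀ i, ((s.piecewise (fun _ => e₁ k) (fun _ => e₂ k) i : (C2 k).carrier) : k × k).2 =
      if i ∈ s then (0 : k) else 1 := fun i => by
    by_cases hi : i ∈ s <;> simp only [Finset.piecewise, hi, if_true, if_false] <;> rfl
  -- Here `s` is the set of positions occupied by `e₁`. The `i`-th factor of the `e₂`-coordinate is
  -- 1 exactly when `s` and the complement of `H` agree at `i`, so the product over `i` is the
  -- indicator of `s = Hᶜ`.
  have h3 : ∀ i, (if i ∈ H.1 then if i ∈ s then (0 : k) else 1 else if i ∈ s then 1 else 0) =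
      if (i ∈ s ↔ i ∈ H.1ᶜ) then 1 else 0 := fun i => by
    by_cases hi : i ∈ s <;> by_cases hi' : i ∈ H.1 <;> simp [hi, hi']
  rw [C2_act_corolla]
  simp only [h1, h2, h3, Finset.prod_ite_zero, Finset.prod_const_one, Finset.mem_univ,
    true_imp_iff, Finset.ext_iff, iff_true]

end ComTrias

/-! ### The elements `e₁ ⊗ p + e₂ ⊗ q` of `C₂ ⊗ V` -/

namespace Tri

variable {k : Type u} [Field k] {N : Operad.{u, v} k}

/-- The element `e₁ ⊗ p + e₂ ⊗ q` of `C₂ ⊗ V`. -/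
noncomputable def pair {V : N.Algebra} (p q : V.carrier) :
    ((ComTrias.C2 k).tensor V).carrier :=
  (ComTrias.e₁ k ⊗ₜ[k] p + ComTrias.e₂ k ⊗ₜ[k] q : (ComTrias.C2 k).carrier ⊗[k] V.carrier)

/-- Of the `2ⁿ` terms in the multilinear expansion, `C₂` annihilates all but two: the one with `e₁`
in every position, and the one with `e₂` exactly in the positions of `H`. The set `H` thus survives
only as the selection rule `mix H`, which is the rule in the definition of `T̃`. -/
lemma act_pair (V : N.Algebra) {n : ℕ} (H : NESub n) (x : N.Op n) (p q : Fin n → V.carrier) :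
    act ((ComTrias.C2 k).tensor V) H x (fun i => pair (p i) (q i)) =
      pair (V.act x p) (V.act x (mix H p q)) := by
  classical
  -- One term of the expansion: `s` records the positions in which the summand `e₁ ⊗ pᵢ` is chosen.
  -- The two indicator terms are added rather than split into cases, so that the sum over `s` can be
  -- evaluated for each of them separately.
  have hs : ∀ s : Finset (Fin n), act ((ComTrias.C2 k).tensor V) H x
      (s.piecewise (fun i => (ComTrias.e₁ k ⊗ₜ[k] p i : (ComTrias.C2 k).carrier ⊗[k] V.carrier))
        fun i => (ComTrias.e₂ k ⊗ₜ[k] q i : (ComTrias.C2 k).carrier ⊗[k] V.carrier)) =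
      ((if s = Finset.univ then (ComTrias.e₁ k ⊗ₜ[k] V.act x p) else 0) +
        (if s = H.1ᶜ then (ComTrias.e₂ k ⊗ₜ[k] V.act x (mix H p q)) else 0) :
          (ComTrias.C2 k).carrier ⊗[k] V.carrier) := by
    intro s
    have h1 : (s.piecewise
        (fun i => (ComTrias.e₁ k ⊗ₜ[k] p i : (ComTrias.C2 k).carrier ⊗[k] V.carrier))
        fun i => (ComTrias.e₂ k ⊗ₜ[k] q i : (ComTrias.C2 k).carrier ⊗[k] V.carrier)) =
        fun i => s.piecewise (fun _ => ComTrias.e₁ k) (fun _ => ComTrias.e₂ k) i ⊗ₜ[k]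
          s.piecewise p q i := by
      funext i
      by_cases hi : i ∈ s <;> simp [hi]
    refine (congrArg (act ((ComTrias.C2 k).tensor V) H x) h1).trans ?_
    refine (Operad.Algebra.tensor_act_tmul _ _ _ _ _ _).trans ?_
    rw [ComTrias.C2_act_corolla_piecewise, TensorProduct.add_tmul]
    congr 1
    · split_ifs with h
      · rw [one_smul, h, Finset.piecewise_univ]
      · rw [zero_smul, TensorProduct.zero_tmul]
    · split_ifs with h
      · have h2 : s.piecewise p q = mix H p q := by
          funext i
          by_cases hi : i ∈ H.1 <;> simp [h, mix, hi]
        rw [one_smul, h2]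
      · rw [zero_smul, TensorProduct.zero_tmul]
  refine (MultilinearMap.map_add_univ (act ((ComTrias.C2 k).tensor V) H x)
    (fun i => (ComTrias.e₁ k ⊗ₜ[k] p i : (ComTrias.C2 k).carrier ⊗[k] V.carrier))
    fun i => (ComTrias.e₂ k ⊗ₜ[k] q i : (ComTrias.C2 k).carrier ⊗[k] V.carrier)).trans ?_
  refine (Finset.sum_congr rfl fun s _ => hs s).trans ?_
  refine Finset.sum_add_distrib.trans ?_
  refine congrArg₂ _ ((Finset.sum_ite_eq' _ _ _).trans (if_pos (Finset.mem_univ _)))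
    ((Finset.sum_ite_eq' _ _ _).trans (if_pos (Finset.mem_univ _)))

lemma pair_add {V : N.Algebra} (p p' q q' : V.carrier) :
    pair (p + p') (q + q') = pair p q + pair p' q' := by
  refine (congrArg₂ (· + ·) (TensorProduct.tmul_add _ _ _) (TensorProduct.tmul_add _ _ _)).trans ?_
  exact add_add_add_comm _ _ _ _

lemma pair_smul {V : N.Algebra} (c : k) (p q : V.carrier) :
    pair (c • p) (c • q) = c • pair p q :=
  (congrArg₂ (· + ·) (TensorProduct.tmul_smul _ _ _) (TensorProduct.tmul_smul _ _ _)).trans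
    (smul_add _ _ _).symm

/-- This is the decomposition `C₂ ⊗ V = e₁ ⊗ V + e₂ ⊗ V`. It reduces identities between operations
on `C₂ ⊗ V` to the formula `act_pair`. -/
lemma exists_eq_pair {V : N.Algebra} (z : ((ComTrias.C2 k).tensor V).carrier) :
    ∃ p q, z = pair p q := by
  suffices h : ∀ z : (k × k) ⊗[k] V.carrier, ∃ p q : V.carrier, z = pair p q from h z
  intro z
  induction z using TensorProduct.induction_on with
  | zero => exact ⟨0, 0, (congrArg₂ (· + ·) (TensorProduct.tmul_zero _ _)
      (TensorProduct.tmul_zero _ _)).trans (add_zero _) |>.symm⟩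
  | add y z hy hz =>
    obtain ⟨p, q, rfl⟩ := hy
    obtain ⟨p', q', rfl⟩ := hz
    exact ⟨p + p', q + q', (pair_add p p' q q').symm⟩
  | tmul c v =>
    refine ⟨c.1 • v, c.2 • v, ?_⟩
    have h : c = c.1 • ((1, 0) : k × k) + c.2 • ((0, 1) : k × k) := by simp
    conv_lhs => rw [h, TensorProduct.add_tmul, TensorProduct.smul_tmul, TensorProduct.smul_tmul]
    rfl

/-- The coordinate functional of `e₂`, tensored with the identity and followed by `k ⊗ V ≅ V`,
recovers `q`. The `e₂`-component alone is enough to make the doubling map injective. -/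
lemma pair_injective_right {V : N.Algebra} {p p' q q' : V.carrier}
    (h : pair p q = pair p' q') : q = q' := by
  have key : ∀ p q : V.carrier, TensorProduct.lid k V.carrier
      (TensorProduct.map (LinearMap.snd k k k) LinearMap.id (pair p q)) = q := by
    intro p q
    show TensorProduct.lid k V.carrier (TensorProduct.map (LinearMap.snd k k k) LinearMap.id
      ((((1, 0) : k × k) ⊗ₜ[k] p) + (((0, 1) : k × k) ⊗ₜ[k] q))) = q
    simp
  rw [← key p q, h, key]

/-! ### Reduction to the operations `e_H ⊗ x` -/

/-- Every operation of `tri-N` is a sum of operations `x^H`. -/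
lemma op_induction {n : ℕ} {C : (Tri N).Op n → Prop} (zero : C 0)
    (add : ∀ y z, C y → C z → C (y + z))
    (corolla : ∀ (H : NESub n) (x : N.Op n), C (ComTrias.corolla k H ⊗ₜ[k] x))
    (z : (Tri N).Op n) : C z := by
  suffices h : ∀ z : (NESub n →₀ k) ⊗[k] N.Op n, C z from h z
  intro z
  induction z using TensorProduct.induction_on with
  | zero => exact zero
  | add y z hy hz => exact add y z hy hz
  | tmul c x =>
    induction c using Finsupp.induction_linear with
    | zero =>
      rw [TensorProduct.zero_tmul]
      exact zero
    | add y z hy hz =>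
      rw [TensorProduct.add_tmul]
      exact add _ _ hy hz
    | single H r =>
      -- The coefficient of `e_H` is absorbed into the second factor, so pure tensors with
      -- coefficient 1 suffice.
      rw [← Finsupp.smul_single_one, TensorProduct.smul_tmul]
      exact corolla H (r • x)

/-- A linear map commuting with all operations `x^H` is a homomorphism of tri-algebras. -/
def homOfAct {S T : (Tri N).Algebra} (φ : S.carrier →ₗ[k] T.carrier)
    (h : ∀ {n : ℕ} (H : NESub n) (x : N.Op n) (a : Fin n → S.carrier),
      φ (act S H x a) = act T H x fun i => φ (a i)) : S.Hom T where
  toLin := φ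
  map_act {n} z a := by
    induction z using op_induction with
    | zero => simp only [map_zero, _root_.zero_apply]
    | add y z hy hz => simp only [map_add, _root_.add_apply, hy, hz]
    | corolla H x => exact h H x a

/-! ### The doubling embedding of `T` into `C₂ ⊗ T̃` -/

/-- All `T`-components of the arguments vanish, and each nonempty `H` puts at least one of them into
`f^H`; so the sum over `H` is zero. The set `K` is free because the values `x^K(a)` for different
`K` agree modulo `T₀`. -/
lemma tilde_act_bar (G : N.Generators) (hG : ∀ f, 2 ≤ G.arity f) (T : (Tri N).Algebra)
    {n : ℕ} (K : NESub n) (x : N.Op n) (a : Fin n → T.carrier) :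
    (tilde T G hG).act x (fun i => bar G hG (a i)) = bar G hG (act T K x a) := by
  refine (tildeFun_eq hG K x a fun _ => 0).trans (congrArg (Prod.mk _) ?_)
  refine Finset.sum_eq_zero fun H _ => ?_
  obtain ⟨i, hi⟩ := H.2
  exact MultilinearMap.map_coord_zero _ i (by simp [mix, hi])

/-- With unbarred arguments exactly in the positions of `H`, the only set whose selection rule meets
no zero component is `H` itself. This isolates the single operation `x^H` of `T` from the sum
defining the operation `x` of `T̃`. -/
lemma tilde_act_mix (G : N.Generators) (hG : ∀ f, 2 ≤ G.arity f) (T : (Tri N).Algebra)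
    {n : ℕ} (H : NESub n) (x : N.Op n) (a : Fin n → T.carrier) :
    (tilde T G hG).act x (mix H (fun i => bar G hG (a i)) fun i => incl G hG (a i)) =
      incl G hG (act T H x a) := by
  classical
  have h : (mix H (fun i => bar G hG (a i)) fun i => incl G hG (a i)) = fun i =>
      ((zeroPart T G).mkQ (if i ∈ H.1 then 0 else a i), if i ∈ H.1 then a i else 0) := by
    funext i
    by_cases hi : i ∈ H.1
    · simp only [mix, hi, if_true, map_zero]; rfl
    · simp only [mix, hi, if_false]; rfl
  rw [h]
  refine (tildeFun_eq hG H x _ _).trans ?_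
  -- Since `H` is nonempty, some argument has zero component in `T̄`, and the `T̄`-component of the
  -- result vanishes.
  obtain ⟨i, hi⟩ := H.2
  rw [MultilinearMap.map_coord_zero _ i (by simp [hi]), map_zero]
  refine congrArg (Prod.mk _) ?_
  rw [Finset.sum_eq_single H]
  · congr 1
    funext j
    by_cases hj : j ∈ H.1 <;> simp [mix, hj]
  · intro K _ hK
    -- Take `j` in the symmetric difference of `K` and `H`. If `j ∈ K`, the rule for `K` selects the
    -- `T`-component of a barred argument; if `j ∈ H`, it selects the `T̄`-component of an unbarred
    -- one. Either is zero.
    obtain ⟨j, hj⟩ : ∃ j, ¬ (j ∈ K.1 ↔ j ∈ H.1) := by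
      by_contra! hcon
      exact hK (NESub.ext_iff'.2 hcon)
    refine MultilinearMap.map_coord_zero _ j ?_
    by_cases h1 : j ∈ K.1 <;> by_cases h2 : j ∈ H.1 <;> simp_all [mix]
  · simp

/-- The homomorphism `T → C₂ ⊗ T̃`, `a ↦ e₁ ⊗ ā + e₂ ⊗ a`, of tri-algebras. -/
noncomputable def doubling (G : N.Generators) (hG : ∀ f, 2 ≤ G.arity f) (T : (Tri N).Algebra) :
    T.Hom ((ComTrias.C2 k).tensor (tilde T G hG)) :=
  homOfAct
    { toFun := fun a => pair (bar G hG a) (incl G hG a)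
      map_add' := fun a b => by
        rw [← pair_add]
        refine congrArg₂ pair (Prod.ext (map_add _ a b) (add_zero _).symm)
          (Prod.ext (add_zero _).symm rfl)
      map_smul' := fun c a => by
        rw [RingHom.id_apply, ← pair_smul]
        refine congrArg₂ pair (Prod.ext (map_smul _ c a) (smul_zero _).symm)
          (Prod.ext (smul_zero _).symm rfl) }
    -- By `act_pair` the claim splits into its `e₁`- and `e₂`-components. The free set in
    -- `tilde_act_bar` has to be taken equal to `H` for both to describe the same element `x^H(a)`.
    (fun H x a => ((act_pair _ H x _ _).trans
      (congrArg₂ pair (tilde_act_bar G hG T H x a) (tilde_act_mix G hG T H x a))).symm)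

/-- The `e₂`-component of the image of `a` is `a` itself, in the summand `T` of `T̃`, where nothing
has been factored out. -/
lemma doubling_injective (G : N.Generators) (hG : ∀ f, 2 ≤ G.arity f) (T : (Tri N).Algebra) :
    Function.Injective (doubling G hG T).toLin := fun _ _ h =>
  congrArg Prod.snd (pair_injective_right h)

/-! ### Functoriality of `C₂ ⊗ V` in `V`, and restriction along `ω` -/

/-- The homomorphism `id ⊗ φ : C₂ ⊗ V → C₂ ⊗ W` induced by `φ : V → W`. -/
noncomputable def tensorMap {V : N.Algebra} {W : N.Algebra} (φ : V.Hom W) :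
    ((ComTrias.C2 k).tensor V).Hom ((ComTrias.C2 k).tensor W) :=
  homOfAct (TensorProduct.map (LinearMap.id : (ComTrias.C2 k).carrier →ₗ[k] _) φ.toLin)
    (by
      intro n H x a
      choose p q ha using fun i => exists_eq_pair (a i)
      obtain rfl : a = fun i => pair (p i) (q i) := funext ha
      have h : ∀ p q : V.carrier,
          TensorProduct.map (LinearMap.id : (ComTrias.C2 k).carrier →ₗ[k] _) φ.toLin (pair p q) =
            pair (φ.toLin p) (φ.toLin q) := fun p q => map_add _ _ _
      refine (congrArg _ (act_pair V H x p q)).trans ((h _ _).trans ?_)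
      refine Eq.trans ?_ ((congrArg _ (funext fun i => h (p i) (q i))).trans
        (act_pair W H x _ _)).symm
      rw [φ.map_act, φ.map_act]
      -- The selection rule `mix H` acts position by position, hence commutes with applying `φ` to
      -- every entry.
      exact congrArg (pair _) (congrArg _ (funext fun i => apply_ite φ.toLin _ _ _)))

lemma tensorMap_pair {V : N.Algebra} {W : N.Algebra} (φ : V.Hom W) (p q : V.carrier) :
    (tensorMap φ).toLin (pair p q) = pair (φ.toLin p) (φ.toLin q) :=
  map_add _ _ _

/-- The identity `C₂ ⊗ W^(ω) → (C₂ ⊗ W)^(id ⊗ ω)`. -/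
noncomputable def tensorRestrict {M : Operad.{u, t} k} (ω : N.Hom M) (W : M.Algebra) :
    ((ComTrias.C2 k).tensor (W.restrict ω)).Hom
      (((ComTrias.C2 k).tensor W).restrict (ω.idTensor (ComTrias k))) :=
  homOfAct (T := ((ComTrias.C2 k).tensor W).restrict (ω.idTensor (ComTrias k)))
    -- On an operation `e_H ⊗ x` both actions unfold to the tensor product of the action of `e_H` on
    -- `C₂` and the action of `ω(x)` on `W`. This definitional equality depends on the operation
    -- being a pure tensor, which is why `homOfAct` is used.
    (LinearMap.id : (ComTrias.C2 k).carrier ⊗[k] W.carrier →ₗ[k] _) (fun _ _ _ => rfl)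

/-! ### Functoriality of the tilde construction -/

/-- True by unfolding, since `id ⊗ ω` sends `e_H ⊗ x` to `e_H ⊗ ω(x)`: the decoration `H` is
untouched by `ω`. -/
lemma hom_act {S : (Tri N).Algebra} {M : Operad.{u, t} k} (ω : N.Hom M) {T : (Tri M).Algebra}
    (φ : S.Hom (T.restrict (ω.idTensor (ComTrias k)))) {n : ℕ} (H : NESub n) (x : N.Op n)
    (a : Fin n → S.carrier) :
    φ.toLin (act S H x a) = act T H (ω.toFun n x) fun i => φ.toLin (a i) :=
  φ.map_act _ a

/-- A generator `f` of `N` goes to `ω(f)`, which need not be among the chosen generators of `M`. So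
one needs that the zero part of `T` contains the differences `x^H(a) - x^K(a)` for every operation
`x` of `M`; that is `zeroPart_ideal`, and it rests on the generators of `M` having arity at least
two. The inclusion lets `φ` descend to the quotients by the zero parts. -/
lemma zeroPart_le_comap {S : (Tri N).Algebra} {M : Operad.{u, t} k} (ω : N.Hom M)
    {T : (Tri M).Algebra} (φ : S.Hom (T.restrict (ω.idTensor (ComTrias k))))
    (GN : N.Generators) (GM : M.Generators) (hM : ∀ f, 2 ≤ GM.arity f) :
    zeroPart S GN ≤ (zeroPart T GM).comap φ.toLin := by
  refine Submodule.span_le.2 ?_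
  rintro _ ⟨f, H, K, a, rfl⟩
  show φ.toLin _ ∈ zeroPart T GM
  rw [map_sub, hom_act, hom_act]
  exact (zeroPart_ideal hM _).1 H K _

/-- The homomorphism `S̃ → T̃^(ω)` induced by a homomorphism `φ : S → T^(id ⊗ ω)`. -/
def tildeMap {S : (Tri N).Algebra} {M : Operad.{u, t} k} (ω : N.Hom M)
    {T : (Tri M).Algebra} (φ : S.Hom (T.restrict (ω.idTensor (ComTrias k))))
    (GN : N.Generators) (hN : ∀ f, 2 ≤ GN.arity f)
    (GM : M.Generators) (hM : ∀ f, 2 ≤ GM.arity f) :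
    (tilde S GN hN).Hom ((tilde T GM hM).restrict ω) where
  toLin := LinearMap.prodMap
    ((zeroPart S GN).mapQ (zeroPart T GM) φ.toLin (zeroPart_le_comap ω φ GN GM hM)) φ.toLin
  map_act {n} x p := by
    -- The formula for the operations of the tilde algebra needs a nonempty set `K`, hence positive
    -- arity. In arity 0 the only operation is zero.
    by_cases hn : 0 < n
    · obtain ⟨a, b, rfl⟩ := exists_pair p
      refine (congrArg _ (tildeFun_eq hN (NESub.full hn) x a b)).trans ?_
      refine Eq.trans ?_ (tildeFun_eq hM (NESub.full hn) (ω.toFun n x) (fun i => φ.toLin (a i))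
        fun i => φ.toLin (b i)).symm
      refine congrArg₂ Prod.mk (congrArg (zeroPart T GM).mkQ (hom_act ω φ _ x a)) ?_
      show φ.toLin (∑ H : NESub n, act S H x (mix H a b)) = _
      rw [map_sum]
      refine Finset.sum_congr rfl fun H _ => ?_
      refine (hom_act ω φ H x _).trans (congrArg _ (funext fun i => ?_))
      -- Applying `φ` commutes with the selection rule `mix H`, entry by entry.
      exact apply_ite φ.toLin _ _ _
    · rw [op_eq_zero hn x]
      simp only [map_zero, _root_.zero_apply]
      exact map_zero (LinearMap.prodMap _ φ.toLin)

lemma tildeMap_bar {S : (Tri N).Algebra} {M : Operad.{u, t} k} (ω : N.Hom M)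
    {T : (Tri M).Algebra} (φ : S.Hom (T.restrict (ω.idTensor (ComTrias k))))
    (GN : N.Generators) (hN : ∀ f, 2 ≤ GN.arity f)
    (GM : M.Generators) (hM : ∀ f, 2 ≤ GM.arity f) (a : S.carrier) :
    (tildeMap ω φ GN hN GM hM).toLin (bar GN hN a) = bar GM hM (φ.toLin a) :=
  congrArg (Prod.mk _) (map_zero φ.toLin)

lemma tildeMap_incl {S : (Tri N).Algebra} {M : Operad.{u, t} k} (ω : N.Hom M)
    {T : (Tri M).Algebra} (φ : S.Hom (T.restrict (ω.idTensor (ComTrias k))))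
    (GN : N.Generators) (hN : ∀ f, 2 ≤ GN.arity f)
    (GM : M.Generators) (hM : ∀ f, 2 ≤ GM.arity f) (a : S.carrier) :
    (tildeMap ω φ GN hN GM hM).toLin (incl GN hN a) = incl GM hM (φ.toLin a) :=
  congrArg (Prod.mk · _) (map_zero ((zeroPart S GN).mapQ (zeroPart T GM) φ.toLin
    (zeroPart_le_comap ω φ GN GM hM)))

end Tri

/-! ### Generation and uniqueness for universal enveloping algebras -/

/-- Both homomorphisms extend `ξ' ∘ ι`, and such an extension is unique. -/
lemma UEnv.hom_ext {k : Type u} [Field k] {N : Operad.{u, t} k} {M : Operad.{u, v} k}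
    {ω : N.Hom M} {B : Operad.Algebra.{u, t, w} N} {A : M.Algebra} {ξ ξ' : (UEnv ω B).Hom A}
    (h : ∀ b, ξ.toLin ((ι ω B).toLin b) = ξ'.toLin ((ι ω B).toLin b)) : ξ = ξ' :=
  (existsUnique_lift ((ι ω B).comp (ξ'.restrict ω))).unique h fun _ => rfl

/-- The range of the homomorphism `U_ω(B) → A` induced by `ψ` is generated by the range of `ψ`. -/
lemma UEnv.range_lift {k : Type u} [Field k] {N : Operad.{u, t} k} {M : Operad.{u, v} k}
    {ω : N.Hom M} {B : Operad.Algebra.{u, t, w} N} {A : M.Algebra} (ψ : B.Hom (A.restrict ω)) :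
    LinearMap.range (lift ψ).toLin = A.adjoinSubmodule (Set.range ψ.toLin) := by
  refine le_antisymm ?_ ((lift ψ).adjoinSubmodule_range_le _ ?_)
  · rintro _ ⟨q, rfl⟩
    obtain ⟨e, rfl⟩ := mk_surjective q
    show eval ψ e ∈ _
    -- Every element of `U_ω(B)` is the class of a formal expression in elements of `B`; its value
    -- stays in the subalgebra at each stage of its construction.
    induction e with
    | of b => exact Submodule.mem_sInf.2 fun S hS => hS.1 ⟨b, rfl⟩
    | zero => exact zero_mem _
    | add a b ha hb => exact add_mem ha hb
    | smul c a ha => exact Submodule.smul_mem _ c ha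
    | op x a ha => exact A.act_mem_adjoinSubmodule _ x _ ha
  · rintro _ ⟨b, rfl⟩
    exact ⟨(ι ω B).toLin b, rfl⟩

/-! ### The isomorphism with the generated subalgebra -/

theorem mainTheorem5 {k : Type*} [Field k] {N M : Operad k}
    (GN : N.Generators) (hN : ∀ f, 2 ≤ GN.arity f)
    (GM : M.Generators) (hM : ∀ f, 2 ≤ GM.arity f)
    (ω : N.Hom M) (T : (Tri N).Algebra) :
    ∃ Φ : (UEnv (ω.idTensor (ComTrias k)) T).Iso
        (((ComTrias.C2 k).tensor (UEnv ω (Tri.tilde T GN hN))).adjoin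
          (Set.range fun a : T.carrier =>
            ComTrias.e₁ k ⊗ₜ[k] (UEnv.ι ω (Tri.tilde T GN hN)).toLin (Tri.bar GN hN a) +
            ComTrias.e₂ k ⊗ₜ[k] (UEnv.ι ω (Tri.tilde T GN hN)).toLin (Tri.incl GN hN a))),
      ∀ a : T.carrier,
        (Φ.toLin ((UEnv.ι (ω.idTensor (ComTrias k)) T).toLin a)).1 =
          ComTrias.e₁ k ⊗ₜ[k] (UEnv.ι ω (Tri.tilde T GN hN)).toLin (Tri.bar GN hN a) +
          ComTrias.e₂ k ⊗ₜ[k] (UEnv.ι ω (Tri.tilde T GN hN)).toLin (Tri.incl GN hN a) := by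
  let U := UEnv (ω.idTensor (ComTrias k)) T
  -- The doubling map of `T`, pushed into `C₂ ⊗ U_ω(T̃)` by `id ⊗ ι` and then read as a map into the
  -- restriction of a tri-`M`-algebra, so that it extends to `U`.
  let τ : T.Hom (((ComTrias.C2 k).tensor (UEnv ω (Tri.tilde T GN hN))).restrict
      (ω.idTensor (ComTrias k))) :=
    ((Tri.doubling GN hN T).comp (Tri.tensorMap (UEnv.ι ω (Tri.tilde T GN hN)))).comp
      (Tri.tensorRestrict ω _)
  have hτ : ∀ a, τ.toLin a = Tri.pair ((UEnv.ι ω (Tri.tilde T GN hN)).toLin (Tri.bar GN hN a))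
      ((UEnv.ι ω (Tri.tilde T GN hN)).toLin (Tri.incl GN hN a)) := fun a =>
    Tri.tensorMap_pair _ _ _
  -- The tilde construction of the tri-`M`-algebra `U` is an `M`-algebra receiving `T̃`, so the
  -- universal property of `U_ω(T̃)` applies.
  let ζ : (UEnv ω (Tri.tilde T GN hN)).Hom (Tri.tilde U GM hM) :=
    UEnv.lift (Tri.tildeMap ω (UEnv.ι (ω.idTensor (ComTrias k)) T) GN hN GM hM)
  -- On the canonical image `u` of `a ∈ T` both sides equal `e₁ ⊗ ū + e₂ ⊗ u`, because `ζ` respects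
  -- bars and inclusions; uniqueness of extensions gives equality on all of `U`.
  have hζ : ((UEnv.lift τ).comp (Tri.tensorMap ζ)) = Tri.doubling GM hM U :=
    UEnv.hom_ext fun a => (congrArg (Tri.tensorMap ζ).toLin (hτ a)).trans
      ((Tri.tensorMap_pair ζ _ _).trans (congrArg₂ Tri.pair
        (Tri.tildeMap_bar ω _ GN hN GM hM a) (Tri.tildeMap_incl ω _ GN hN GM hM a)))
  -- The extension of `τ` is the inner factor of an injective composite.
  have hinj : Function.Injective (UEnv.lift τ).toLin := by
    have h := Tri.doubling_injective GM hM U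
    rw [← hζ] at h
    exact Function.Injective.of_comp h
  -- The formula for the image of each `a ∈ T` is `hτ` once more, since the extension of `τ` takes
  -- the value `τ(a)` at the canonical image of `a` by definition.
  exact ⟨(UEnv.lift τ).isoAdjoin hinj _
    ((UEnv.range_lift τ).trans (congrArg _ (congrArg Set.range (funext hτ)))), hτ⟩
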